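/- Let $p,q\colon[0,\infty)\to\mathbb R$ be continuously differentiable and bounded. Consider the dynamical Dirac system $$\mathrm i u_t+Ju_x+\mathcal V u=0\quad(x\ge 0,\ t\ge 0),\qquad u=\begin{bmatrix}u_1\\u_2\end{bmatrix},\quad J=\begin{bmatrix}0&1\\-1&0\end{bmatrix},\quad \mathcal V=\begin{bmatrix}p&q\\q&-p\end{bmatrix},$$ with $u(x,0)=0$ for $x\ge0$, $u_1(0,t)=f(t)$ for $t\ge0$, and $u(x,t)=0$ for $0\le t<x$. Here the controls $f\colon\mathbb R\to\mathbb C$ are continuously differentiable with $f(t)=f'(t)=0$ for $t\le 0$ and with $f,f'$ bounded, and solutions are classical: $u,u_x,u_t$ are continuous on the closed quarter-plane. Let $r$ be the response function of this system, i.e. the continuous function on $[0,\infty)$ such that for all such controls $f$ and the corresponding solutions $u$ $$u_2(0,t)=\mathrm i f(t)+\int_0^t r(t-\tau)f(\tau)\,d\tau\qquad(t\ge0).$$ Let $\varphi_H$ be the Herglotz Weyl function of the corresponding spectral Dirac system $$y'(x,z)=\mathrm i\,(zj+jV(x))\,y(x,z)\quad(x\ge0),\qquad j=\begin{bmatrix}1&0\\0&-1\end{bmatrix},\quad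 V=\begin{bmatrix}0&v\\\overline v&0\end{bmatrix},\quad v=\mathrm i q-p,$$ that is, the function on $\{z:\Im z>0\}$ determined by $$\int_0^\infty\begin{bmatrix}1&\mathrm i\,\overline{\varphi_H(z)}\end{bmatrix}K\,Y(x,z)^*Y(x,z)K^*\begin{bmatrix}1\\-\mathrm i\varphi_H(z)\end{bmatrix}dx<\infty,\qquad K=\frac1{\sqrt2}\begin{bmatrix}1&-1\\1&1\end{bmatrix},$$ where $Y(\cdot,z)$ is the fundamental solution with $Y(0,z)=I_2$. Then the formula $$\overline{s(x)}=\frac{d}{dx}\left(\frac{\mathrm i}{4\pi}\,\mathrm e^{\eta x}\ \underset{a\to\infty}{\mathrm{l.i.m.}}\int_{-a}^{a}\mathrm e^{-\mathrm i\xi x}(\xi+\mathrm i\eta)^{-2}\varphi_H(\xi+\mathrm i\eta)\,d\xi\right)\qquad(x>0)$$ gives a well-defined function $s$ on $(0,\infty)$ which is differentiable there. Here well-defined means: for every $\eta>0$ the function $\xi\mapsto(\xi+\mathrm i\eta)^{-2}\varphi_H(\xi+\mathrm i\eta)$ belongs to $L^2(\mathbb R)$, the limit in the mean (l.i.m.)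 exists in $L^2(0,\infty)$, it has a representative that is differentiable on $(0,\infty)$, and the resulting $s$ is unique and does not depend on $\eta$. Moreover, $$r(t)=2\mathrm i\,\overline{s'(t)}\qquad(t>0),$$ that is, the response function of the dynamical Dirac system coincides with the $A$-amplitude $2\mathrm i\,\overline{s'}$ of the corresponding spectral Dirac system. -/

import Mathlib

open MeasureTheory Filter Set Topology
open scoped Matrix

noncomputable section

namespace DiracResponse

/-! ### The dynamical Dirac system `i u_t + J u_x + 𝒱 u = 0` -/

/-- The matrix `J = [0 1; -1 0]`. -/
def J : Matrix (Fin 2) (Fin 2) ℂ := !![0, 1; -1, 0]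

/-- The potential `𝒱(x) = [p q; q -p]`. -/
def dynPotential (p q : ℝ → ℝ) (x : ℝ) : Matrix (Fin 2) (Fin 2) ℂ :=
  !![(p x : ℂ), (q x : ℂ); (q x : ℂ), -(p x : ℂ)]

/-- Admissible boundary controls: continuously differentiable, `f(t) = f'(t) = 0` for `t ≤ 0`,
with `f` and `f'` bounded. -/
structure IsAdmissibleControl (f : ℝ → ℂ) : Prop where
  contDiff : ContDiff ℝ 1 f
  eq_zero : ∀ t ≤ 0, f t = 0
  deriv_eq_zero : ∀ t ≤ 0, deriv f t = 0
  bounded : ∃ C : ℝ, ∀ t, ‖f t‖ ≤ C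
  deriv_bounded : ∃ C : ℝ, ∀ t, ‖deriv f t‖ ≤ C

/-- The closed quarter plane `x ≥ 0`, `t ≥ 0`. -/
def quarterPlane : Set (ℝ × ℝ) := Ici 0 ×ˢ Ici 0

/-- `u` is a classical solution in the quarter plane of the dynamical Dirac system with
potential `[p q; q -p]` and boundary control `f`, with finite domain of influence. Derivatives
at boundary points are one-sided, and `u`, `u_x`, `u_t` are continuous up to the boundary. -/
structure IsDynamicalSolution (p q : ℝ → ℝ) (f : ℝ → ℂ) (u : ℝ → ℝ → Fin 2 → ℂ) : Prop where
  classical : ∃ ux ut : ℝ → ℝ → Fin 2 → ℂ,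
    ContinuousOn (fun z : ℝ × ℝ => u z.1 z.2) quarterPlane ∧
    ContinuousOn (fun z : ℝ × ℝ => ux z.1 z.2) quarterPlane ∧
    ContinuousOn (fun z : ℝ × ℝ => ut z.1 z.2) quarterPlane ∧
    ∀ x t : ℝ, 0 ≤ x → 0 ≤ t →
      HasDerivWithinAt (fun x' => u x' t) (ux x t) (Ici 0) x ∧
      HasDerivWithinAt (fun t' => u x t') (ut x t) (Ici 0) t ∧
      Complex.I • ut x t + J *ᵥ ux x t + dynPotential p q x *ᵥ u x t = 0
  initial : ∀ x : ℝ, 0 ≤ x → u x 0 = 0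
  boundary : ∀ t : ℝ, 0 ≤ t → u 0 t 0 = f t
  finite_influence : ∀ x t : ℝ, 0 ≤ t → t < x → u x t = 0

/-- `r` is the response function of the dynamical Dirac system: `r` is continuous on `[0, ∞)`
and the response operator `u₁(0,·) ↦ u₂(0,·)` is `f ↦ i f + r * f`. -/
structure IsResponseFunction (p q : ℝ → ℝ) (r : ℝ → ℂ) : Prop where
  continuousOn : ContinuousOn r (Ici 0)
  response : ∀ (f : ℝ → ℂ) (u : ℝ → ℝ → Fin 2 → ℂ), IsAdmissibleControl f →
    IsDynamicalSolution p q f u →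
      ∀ t : ℝ, 0 ≤ t → u 0 t 1 = Complex.I * f t + ∫ τ in (0 : ℝ)..t, r (t - τ) * f τ

/-! ### The spectral Dirac system `y' = i (z j + j V) y` -/

/-- The matrix `j = diag(1, -1)`. -/
def jMat : Matrix (Fin 2) (Fin 2) ℂ := !![1, 0; 0, -1]

/-- The potential `V(x) = [0 v(x); conj v(x) 0]`. -/
def specPotential (v : ℝ → ℂ) (x : ℝ) : Matrix (Fin 2) (Fin 2) ℂ :=
  !![0, v x; (starRingEnd ℂ) (v x), 0]

/-- The function `v = i q - p` of the spectral Dirac system that corresponds to the dynamical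
system with potential `[p q; q -p]`. -/
def assocV (p q : ℝ → ℝ) (x : ℝ) : ℂ := Complex.I * (q x : ℂ) - (p x : ℂ)

/-- `Y` is the fundamental solution, on `x ≥ 0`, of the spectral Dirac system at the spectral
parameter `z`, normalized by `Y(0) = 1`. -/
structure IsFundamentalSolution (v : ℝ → ℂ) (z : ℂ) (Y : ℝ → Matrix (Fin 2) (Fin 2) ℂ) :
    Prop where
  normalized : Y 0 = 1
  ode : ∀ x : ℝ, 0 ≤ x → ∀ a b : Fin 2,
    HasDerivWithinAt (fun x' => Y x' a b)
      (((Complex.I • (z • jMat + jMat * specPotential v x)) * Y x) a b) (Ici 0) x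

/-- The matrix `K = 2^{-1/2} [1 -1; 1 1]`. -/
def K : Matrix (Fin 2) (Fin 2) ℂ :=
  ((1 / Real.sqrt 2 : ℝ) : ℂ) • !![1, -1; 1, 1]

/-- `φ` is (on the open upper half-plane) the Herglotz Weyl function of the spectral Dirac
system: for `Im z > 0`, the solution `w(x) = Y(x,z) K^* [1; -i φ(z)]` has `w^* w` integrable
over `(0, ∞)`. -/
def IsHerglotzWeyl (v : ℝ → ℂ) (φ : ℂ → ℂ) : Prop :=
  ∀ z : ℂ, 0 < z.im → ∃ Y : ℝ → Matrix (Fin 2) (Fin 2) ℂ, IsFundamentalSolution v z Y ∧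
    IntegrableOn
      (fun x => star (Y x *ᵥ (Kᴴ *ᵥ ![1, -Complex.I * φ z])) ⬝ᵥ
        (Y x *ᵥ (Kᴴ *ᵥ ![1, -Complex.I * φ z])))
      (Ioi 0) volume

/-! ### The function `s` -/

/-- The function `ξ ↦ (ξ + i η)⁻² φ(ξ + i η)` on the real line. -/
def weighted (φ : ℂ → ℂ) (η ξ : ℝ) : ℂ :=
  ((ξ : ℂ) + Complex.I * (η : ℂ))⁻¹ ^ 2 * φ ((ξ : ℂ) + Complex.I * (η : ℂ))

/-- The truncated integral `∫_{-a}^{a} e^{-iξx} (ξ + i η)⁻² φ(ξ + i η) dξ`. -/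
def truncated (φ : ℂ → ℂ) (η a x : ℝ) : ℂ :=
  ∫ ξ in (-a)..a, Complex.exp (-Complex.I * (ξ : ℂ) * (x : ℂ)) * weighted φ η ξ

/-- `g` is the limit in the mean `l.i.m._{a → ∞}` of `F a` in `L²(0, ∞)`. -/
def IsLimInMean (F : ℝ → ℝ → ℂ) (g : ℝ → ℂ) : Prop :=
  (∀ a : ℝ, 0 < a → MemLp (F a) 2 (volume.restrict (Ioi 0))) ∧
  MemLp g 2 (volume.restrict (Ioi 0)) ∧
  Tendsto (fun a : ℝ => eLpNorm (fun x => F a x - g x) 2 (volume.restrict (Ioi 0)))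
    atTop (𝓝 0)

/-- `s` is given on `(0, ∞)`, for the chosen `η`, by
`conj s(x) = d/dx ( (i / 4π) e^{ηx} l.i.m._{a → ∞} ∫_{-a}^{a} e^{-iξx} (ξ+iη)⁻² φ(ξ+iη) dξ )`:
the integrand is in `L²(ℝ)`, the limit in the mean exists in `L²(0, ∞)`, and it has a
representative for which the derivative exists and equals `conj s(x)` at every `x > 0`. -/
def IsGivenByWeyl (φ : ℂ → ℂ) (η : ℝ) (s : ℝ → ℂ) : Prop :=
  MemLp (weighted φ η) 2 volume ∧
  ∃ g : ℝ → ℂ, IsLimInMean (truncated φ η) g ∧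
    ∀ x : ℝ, 0 < x →
      HasDerivAt
        (fun x' : ℝ => Complex.I / (4 * (Real.pi : ℂ)) * (Real.exp (η * x') : ℂ) * g x')
        ((starRingEnd ℂ) (s x)) x

/-- The `A`-amplitude `2 i conj (s'(t))` of the spectral Dirac system. -/
def aAmplitude (s : ℝ → ℂ) (t : ℝ) : ℂ := 2 * Complex.I * (starRingEnd ℂ) (deriv s t)

end DiracResponse

end

namespace DiracResponse

/-! Separation of variables links the two systems: if `y` solves `J y' + (z + 𝒱) y = 0`, then
`e^{-izt} y(x)` solves the dynamical system. The Weyl solution, rotated and normalized to `y(0) =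
(1, φ(z))`, is therefore the transform of a causal wave. If `k` is the Laplace transform of a
control `f`, integrating `e^{-izt} k(z) y(x, z)` over a line `Im z = η` and dividing by `2π` gives a
solution with `u₁(0,·) = f`, and `u₂(0,·)` is the inverse transform of `k φ`. By definition of the
response function, `u₂(0,·)` is also `i f + r * f`. No uniqueness theorem for the dynamical system
is needed: `IsResponseFunction` speaks of every solution, so one explicit solution is enough.

For this the Weyl solutions must be holomorphic in `z` and bounded by a multiple of `e^{(M - Im z)
x}` for `Im z ≥ η`. Square integrability forces the cone `|b| ≤ |a|` (`norm_snd_le`), which gives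
the exponential bound and the nonvanishing of `a`. A Wronskian identity gives holomorphy of `b/a` at
`0` (`norm_snd_sub_sub_le`), translation gives it at every `x`, and `a = exp(i(zx + ∫ v b/a))`
transfers it to `a` and `b`. Normalizing divides by `1 - b(0)`; this stays away from `0` on `Im z ≥
η` because `b(0)` is small at high energy (`norm_ratio_le`, where continuous differentiability of
`p` and `q` enters) and the remaining region is compact. The outcome is
`exists_isNormalizedWeylFamily`.

The control is `f(t) = t₊² e^{-εt}`, with `k(z) = 2/(ε - iz)³`: cubic decay makes the integrals for
`u` and both derivatives absolutely convergent, and moving the line to `Im z = ∞` proves `u = 0` for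
`t ≤ x` (`laplaceInv_eq_zero`, `isDynamicalSolution`). Letting `ε → 0` and differentiating once in
`t` turns `k` into `-2 z⁻²`, hence (`integral_weighted_eq`) `e^{ηt} ∫ e^{-iξt} (ξ+iη)⁻² φ(ξ+iη) dξ =
-2π (i t + ∫₀ᵗ (t-σ) r(σ) dσ)`. Multiplying by `i/4π` and differentiating gives `conj s = 1/2 -
(i/2) ∫₀ᵗ r`, free of `η`, and so `2i conj s' = r`. Plancherel identifies the limit in the mean with
the absolutely convergent integral. -/

/-- A square integrable solution `(a, b)` on `[0, ∞)` of the spectral Dirac system. -/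
structure IsWeylPair (v : ℝ → ℂ) (z : ℂ) (a b : ℝ → ℂ) : Prop where
  deriv_fst : ∀ x, 0 ≤ x →
    HasDerivWithinAt a (Complex.I * (z * a x + v x * b x)) (Ici 0) x
  deriv_snd : ∀ x, 0 ≤ x →
    HasDerivWithinAt b (-(Complex.I * (z * b x + (starRingEnd ℂ) (v x) * a x))) (Ici 0) x
  integrable_sq : IntegrableOn (fun x => ‖a x‖ ^ 2 + ‖b x‖ ^ 2) (Ioi 0)

/-! ### Calculus on the half-line. -/

lemma continuousOn_of_hasDerivWithinAt {E : Type*} [NormedAddCommGroup E] [NormedSpace ℝ E]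
    {s : Set ℝ} {f f' : ℝ → E} (h : ∀ x ∈ s, HasDerivWithinAt f (f' x) s x) :
    ContinuousOn f s := fun x hx => (h x hx).continuousWithinAt

/-- Integrability of both `f` and `f'` forces `f → 0` at infinity, so only the boundary term at `0`
survives. All energy identities below are instances. -/
lemma integral_Ioi_deriv_eq_neg {E : Type*} [NormedAddCommGroup E] [NormedSpace ℝ E]
    [CompleteSpace E] {f f' : ℝ → E}
    (hd : ∀ x, 0 ≤ x → HasDerivWithinAt f (f' x) (Ici 0) x)
    (hf : IntegrableOn f (Ioi 0)) (hf' : IntegrableOn f' (Ioi 0)) :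
    ∫ x in Ioi 0, f' x = -f 0 := by
  have hd' : ∀ x ∈ Ioi (0 : ℝ), HasDerivAt f (f' x) x := fun x hx =>
    (hd x (le_of_lt hx)).hasDerivAt (Ici_mem_nhds hx)
  have hlim := tendsto_zero_of_hasDerivAt_of_integrableOn_Ioi hd' hf' hf
  rw [integral_Ioi_of_hasDerivAt_of_tendsto (((hd 0 le_rfl).continuousWithinAt)) hd' hf' hlim]
  simp

lemma integrableOn_mul_of_sq {f g : ℝ → ℂ} (hf : ContinuousOn f (Ici 0))
    (hg : ContinuousOn g (Ici 0)) (hf2 : IntegrableOn (fun x => ‖f x‖ ^ 2) (Ioi 0))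
    (hg2 : IntegrableOn (fun x => ‖g x‖ ^ 2) (Ioi 0)) :
    IntegrableOn (fun x => f x * g x) (Ioi 0) := by
  refine Integrable.mono' (hf2.add hg2) ?_ ?_
  · exact ((hf.mul hg).mono Ioi_subset_Ici_self).aestronglyMeasurable measurableSet_Ioi
  · refine Eventually.of_forall fun x => ?_
    simp only [norm_mul, Pi.add_apply]
    nlinarith [sq_nonneg (‖f x‖ - ‖g x‖), sq_nonneg (‖f x‖), sq_nonneg ‖g x‖]

lemma inner_I_mul (z a w : ℂ) :
    inner ℝ a (Complex.I * (z * a + w)) = -z.im * ‖a‖ ^ 2 + inner ℝ a (Complex.I * w) := by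
  rw [Complex.sq_norm, Complex.normSq_apply]
  simp [Complex.inner, Complex.mul_re, Complex.mul_im]
  ring

lemma abs_inner_I_mul_mul_le (a v b : ℂ) :
    |inner ℝ a (Complex.I * (v * b))| ≤ ‖a‖ * (‖v‖ * ‖b‖) := by
  refine (abs_real_inner_le_norm _ _).trans (le_of_eq ?_)
  simp

/-! ### Weyl solutions at a fixed spectral parameter. -/

namespace IsWeylPair

variable {v : ℝ → ℂ} {z : ℂ} {a b : ℝ → ℂ} {M : ℝ}

lemma continuousOn_fst (h : IsWeylPair v z a b) : ContinuousOn a (Ici 0) :=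
  continuousOn_of_hasDerivWithinAt h.deriv_fst

lemma continuousOn_snd (h : IsWeylPair v z a b) : ContinuousOn b (Ici 0) :=
  continuousOn_of_hasDerivWithinAt h.deriv_snd

lemma integrable_fst (h : IsWeylPair v z a b) :
    IntegrableOn (fun x => ‖a x‖ ^ 2) (Ioi 0) := by
  refine Integrable.mono' h.integrable_sq ?_ (Eventually.of_forall fun x => ?_)
  · exact ((h.continuousOn_fst.norm.pow 2).mono Ioi_subset_Ici_self).aestronglyMeasurable
      measurableSet_Ioi
  · rw [Real.norm_of_nonneg (by positivity)]
    nlinarith [sq_nonneg ‖b x‖]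

lemma integrable_snd (h : IsWeylPair v z a b) :
    IntegrableOn (fun x => ‖b x‖ ^ 2) (Ioi 0) := by
  refine Integrable.mono' h.integrable_sq ?_ (Eventually.of_forall fun x => ?_)
  · exact ((h.continuousOn_snd.norm.pow 2).mono Ioi_subset_Ici_self).aestronglyMeasurable
      measurableSet_Ioi
  · rw [Real.norm_of_nonneg (by positivity)]
    nlinarith [sq_nonneg ‖a x‖]

lemma const_mul (h : IsWeylPair v z a b) (c : ℂ) :
    IsWeylPair v z (fun x => c * a x) (fun x => c * b x) where
  deriv_fst x hx := by
    refine ((h.deriv_fst x hx).const_mul c).congr_deriv ?_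
    ring
  deriv_snd x hx := by
    refine ((h.deriv_snd x hx).const_mul c).congr_deriv ?_
    ring
  integrable_sq := by
    have := h.integrable_sq.const_mul (‖c‖ ^ 2)
    refine this.congr (Eventually.of_forall fun x => ?_)
    simp only [norm_mul]; ring

lemma shift (h : IsWeylPair v z a b) {y : ℝ} (hy : 0 ≤ y) :
    IsWeylPair (fun x => v (y + x)) z (fun x => a (y + x)) (fun x => b (y + x)) where
  deriv_fst x hx := by
    have h1 : HasDerivWithinAt (fun x => y + x) 1 (Ici 0) x :=
      ((hasDerivAt_id x).const_add y).hasDerivWithinAt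
    have := (h.deriv_fst (y + x) (by positivity)).scomp x h1
      (fun t ht => by simp only [mem_Ici] at *; linarith)
    simpa [Function.comp_def] using this
  deriv_snd x hx := by
    have h1 : HasDerivWithinAt (fun x => y + x) 1 (Ici 0) x :=
      ((hasDerivAt_id x).const_add y).hasDerivWithinAt
    have := (h.deriv_snd (y + x) (by positivity)).scomp x h1
      (fun t ht => by simp only [mem_Ici] at *; linarith)
    simpa [Function.comp_def] using this
  integrable_sq := by
    have h1 : IntegrableOn (fun x => ‖a x‖ ^ 2 + ‖b x‖ ^ 2) (Ioi y) :=
      h.integrable_sq.mono_set (Ioi_subset_Ioi hy)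
    have h2 := (measurePreserving_add_left volume y).integrableOn_comp_preimage
      (measurableEmbedding_addLeft y) (f := fun x => ‖a x‖ ^ 2 + ‖b x‖ ^ 2) (s := Ioi y)
    have h3 := h2.2 h1
    simpa [Function.comp_def] using h3

/-- The potential cancels in the derivative of the indefinite form `w* j w`; only `Im z` remains. -/
lemma hasDerivWithinAt_norm_sq_sub (h : IsWeylPair v z a b) {x : ℝ} (hx : 0 ≤ x) :
    HasDerivWithinAt (fun x => ‖a x‖ ^ 2 - ‖b x‖ ^ 2)
      (-2 * z.im * (‖a x‖ ^ 2 + ‖b x‖ ^ 2)) (Ici 0) x := by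
  refine ((h.deriv_fst x hx).norm_sq.sub (h.deriv_snd x hx).norm_sq).congr_deriv ?_
  simp only [Complex.sq_norm, Complex.normSq_apply]
  simp [Complex.inner, Complex.mul_re, Complex.mul_im]
  ring

/-- A Weyl solution takes its values in the cone `‖b‖ ≤ ‖a‖`. -/
lemma norm_snd_le (h : IsWeylPair v z a b) (hz : 0 < z.im) {x : ℝ} (hx : 0 ≤ x) :
    ‖b x‖ ≤ ‖a x‖ := by
  have hanti : AntitoneOn (fun x => ‖a x‖ ^ 2 - ‖b x‖ ^ 2) (Ici 0) := by
    refine antitoneOn_of_hasDerivWithinAt_nonpos (convex_Ici 0)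
      (continuousOn_of_hasDerivWithinAt fun x hx => h.hasDerivWithinAt_norm_sq_sub hx)
      (fun x hx => (h.hasDerivWithinAt_norm_sq_sub (interior_subset hx)).mono interior_subset)
      fun x _ => ?_
    have : 0 ≤ z.im * (‖a x‖ ^ 2 + ‖b x‖ ^ 2) := by positivity
    linarith
  -- A negative value of `|a|² - |b|²` can only decrease further, so `|b|² ≥ d > 0` on a whole
  -- half-line, against square integrability.
  by_contra! hlt
  set d := ‖b x‖ ^ 2 - ‖a x‖ ^ 2 with hd
  have hdpos : 0 < d := by
    have := norm_nonneg (a x)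
    rw [hd]; nlinarith
  have hint : IntegrableOn (fun _ : ℝ => d) (Ioi x) := by
    refine Integrable.mono' (h.integrable_snd.mono_set (Ioi_subset_Ioi hx))
      aestronglyMeasurable_const ?_
    filter_upwards [ae_restrict_mem measurableSet_Ioi] with y hy
    have := hanti hx (hx.trans (le_of_lt hy)) (le_of_lt hy)
    simp only at this
    rw [Real.norm_of_nonneg hdpos.le]
    nlinarith [sq_nonneg ‖a y‖]
  rw [integrableOn_const_iff] at hint
  simp [hdpos.ne'] at hint

/-- An integrating factor with free rate `c`: since the inner product is at most `M |a|²` in size,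
`c = Im z + M` makes the product increase and `c = Im z - M` makes it decrease. -/
lemma hasDerivWithinAt_norm_sq_mul_exp (h : IsWeylPair v z a b) (c : ℝ) {x : ℝ} (hx : 0 ≤ x) :
    HasDerivWithinAt (fun x => ‖a x‖ ^ 2 * Real.exp (2 * c * x))
      (2 * ((c - z.im) * ‖a x‖ ^ 2 + inner ℝ (a x) (Complex.I * (v x * b x))) *
        Real.exp (2 * c * x)) (Ici 0) x := by
  have h1 := (h.deriv_fst x hx).norm_sq
  rw [inner_I_mul] at h1
  have h2 : HasDerivWithinAt (fun x => Real.exp (2 * c * x)) (Real.exp (2 * c * x) * (2 * c))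
      (Ici 0) x := by
    simpa using (((hasDerivAt_id x).const_mul (2 * c)).exp).hasDerivWithinAt
  refine (h1.mul h2).congr_deriv ?_
  ring

lemma abs_inner_le (h : IsWeylPair v z a b) (hz : 0 < z.im)
    (hv : ∀ x, 0 ≤ x → ‖v x‖ ≤ M) {x : ℝ} (hx : 0 ≤ x) :
    |inner ℝ (a x) (Complex.I * (v x * b x))| ≤ M * ‖a x‖ ^ 2 := by
  refine (abs_inner_I_mul_mul_le _ _ _).trans ?_
  have h0 : 0 ≤ M := (norm_nonneg _).trans (hv x hx)
  calc ‖a x‖ * (‖v x‖ * ‖b x‖) ≤ ‖a x‖ * (M * ‖a x‖) := by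
        gcongr
        exacts [hv x hx, h.norm_snd_le hz hx]
    _ = _ := by ring

lemma fst_ne_zero (h : IsWeylPair v z a b) (hz : 0 < z.im)
    (hv : ∀ x, 0 ≤ x → ‖v x‖ ≤ M) (ha : a 0 ≠ 0) {x : ℝ} (hx : 0 ≤ x) : a x ≠ 0 := by
  have hmono : MonotoneOn (fun x => ‖a x‖ ^ 2 * Real.exp (2 * (z.im + M) * x)) (Ici 0) := by
    refine monotoneOn_of_hasDerivWithinAt_nonneg (convex_Ici 0)
      (continuousOn_of_hasDerivWithinAt fun x hx => h.hasDerivWithinAt_norm_sq_mul_exp _ hx)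
      (fun x hx => (h.hasDerivWithinAt_norm_sq_mul_exp _ (interior_subset hx)).mono
        interior_subset) fun x hx' => ?_
    have := (abs_le.1 (h.abs_inner_le hz hv (interior_subset hx'))).1
    refine mul_nonneg (mul_nonneg two_pos.le ?_) (Real.exp_pos _).le
    linarith
  intro h0
  have := hmono self_mem_Ici hx hx
  simp only [h0, norm_zero, mul_zero, Real.exp_zero, mul_one] at this
  have h1 : 0 < ‖a 0‖ := norm_pos_iff.2 ha
  nlinarith

lemma norm_fst_le (h : IsWeylPair v z a b) (hz : 0 < z.im)
    (hv : ∀ x, 0 ≤ x → ‖v x‖ ≤ M) {x : ℝ} (hx : 0 ≤ x) :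
    ‖a x‖ ≤ ‖a 0‖ * Real.exp ((M - z.im) * x) := by
  have hanti : AntitoneOn (fun x => ‖a x‖ ^ 2 * Real.exp (2 * (z.im - M) * x)) (Ici 0) := by
    refine antitoneOn_of_hasDerivWithinAt_nonpos (convex_Ici 0)
      (continuousOn_of_hasDerivWithinAt fun x hx => h.hasDerivWithinAt_norm_sq_mul_exp _ hx)
      (fun x hx => (h.hasDerivWithinAt_norm_sq_mul_exp _ (interior_subset hx)).mono
        interior_subset) fun x hx' => ?_
    have := (abs_le.1 (h.abs_inner_le hz hv (interior_subset hx'))).2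
    refine mul_nonpos_of_nonpos_of_nonneg
      (mul_nonpos_of_nonneg_of_nonpos two_pos.le ?_) (Real.exp_pos _).le
    linarith
  have h1 := hanti self_mem_Ici hx hx
  simp only [mul_zero, Real.exp_zero, mul_one] at h1
  refine le_of_sq_le_sq ?_ (by positivity)
  have h2 : Real.exp ((M - z.im) * x) ^ 2 * Real.exp (2 * (z.im - M) * x) = 1 := by
    rw [← Real.exp_nat_mul, ← Real.exp_add, Real.exp_eq_one_iff]; push_cast; ring
  have h3 : 0 < Real.exp ((M - z.im) * x) ^ 2 := by positivity
  calc ‖a x‖ ^ 2 = (‖a x‖ ^ 2 * Real.exp (2 * (z.im - M) * x)) *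
        Real.exp ((M - z.im) * x) ^ 2 := by rw [mul_assoc, mul_comm (Real.exp _), h2, mul_one]
    _ ≤ ‖a 0‖ ^ 2 * Real.exp ((M - z.im) * x) ^ 2 := by gcongr
    _ = _ := by ring

/-- Integrating the energy identity gives `2 Im z ∫ (|a|² + |b|²) = |a(0)|² - |b(0)|²`. -/
lemma integral_sq_le (h : IsWeylPair v z a b) (hz : 0 < z.im) :
    ∫ x in Ioi 0, (‖a x‖ ^ 2 + ‖b x‖ ^ 2) ≤ ‖a 0‖ ^ 2 / (2 * z.im) := by
  have h1 := integral_Ioi_deriv_eq_neg (fun x hx => h.hasDerivWithinAt_norm_sq_sub hx)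
    (h.integrable_fst.sub h.integrable_snd) (h.integrable_sq.const_mul _)
  rw [integral_const_mul] at h1
  rw [le_div_iff₀ (by positivity)]
  nlinarith [sq_nonneg ‖b 0‖]

/-! ### Dependence on the spectral parameter. -/

section Difference

variable {z₀ : ℂ} {a₀ b₀ : ℝ → ℂ}

lemma hasDerivWithinAt_norm_sq_sub_difference (h : IsWeylPair v z a b)
    (h₀ : IsWeylPair v z₀ a₀ b₀) {x : ℝ} (hx : 0 ≤ x) :
    HasDerivWithinAt (fun x => ‖a x - a₀ x‖ ^ 2 - ‖b x - b₀ x‖ ^ 2)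
      (-2 * z₀.im * (‖a x - a₀ x‖ ^ 2 + ‖b x - b₀ x‖ ^ 2) +
        2 * (inner ℝ (a x - a₀ x) (Complex.I * ((z - z₀) * a x)) +
          inner ℝ (b x - b₀ x) (Complex.I * ((z - z₀) * b x)))) (Ici 0) x := by
  refine (((h.deriv_fst x hx).sub (h₀.deriv_fst x hx)).norm_sq.sub
    ((h.deriv_snd x hx).sub (h₀.deriv_snd x hx)).norm_sq).congr_deriv ?_
  simp only [Complex.sq_norm, Complex.normSq_apply]
  simp [Complex.inner, Complex.mul_re, Complex.mul_im]
  ring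

lemma integrable_sub_sq (h : IsWeylPair v z a b) (h₀ : IsWeylPair v z₀ a₀ b₀) :
    IntegrableOn (fun x => ‖a x - a₀ x‖ ^ 2) (Ioi 0) ∧
      IntegrableOn (fun x => ‖b x - b₀ x‖ ^ 2) (Ioi 0) := by
  have key : ∀ f g : ℝ → ℂ, ContinuousOn f (Ici 0) → ContinuousOn g (Ici 0) →
      IntegrableOn (fun x => ‖f x‖ ^ 2) (Ioi 0) → IntegrableOn (fun x => ‖g x‖ ^ 2) (Ioi 0) →
      IntegrableOn (fun x => ‖f x - g x‖ ^ 2) (Ioi 0) := by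
    intro f g hf hg hf2 hg2
    refine Integrable.mono' ((hf2.add hg2).const_mul 2)
      ((((hf.sub hg).norm.pow 2).mono Ioi_subset_Ici_self).aestronglyMeasurable
        measurableSet_Ioi) (Eventually.of_forall fun x => ?_)
    rw [Real.norm_of_nonneg (by positivity)]
    have := norm_sub_le (f x) (g x)
    have h0 := norm_nonneg (f x - g x)
    simp only [Pi.add_apply]
    nlinarith [sq_nonneg (‖f x‖ - ‖g x‖)]
  exact ⟨key _ _ h.continuousOn_fst h₀.continuousOn_fst h.integrable_fst h₀.integrable_fst,
    key _ _ h.continuousOn_snd h₀.continuousOn_snd h.integrable_snd h₀.integrable_snd⟩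

lemma two_mul_inner_le {η : ℝ} (hη : 0 < η) (c h w : ℂ) :
    2 * inner ℝ c (Complex.I * (h * w)) ≤ η * ‖c‖ ^ 2 + ‖h‖ ^ 2 / η * ‖w‖ ^ 2 := by
  have h1 := (le_abs_self _).trans (abs_inner_I_mul_mul_le c h w)
  have h2 : 0 ≤ (η * ‖c‖ - ‖h‖ * ‖w‖) ^ 2 / η := by positivity
  have h3 : (η * ‖c‖ - ‖h‖ * ‖w‖) ^ 2 / η =
      η * ‖c‖ ^ 2 + ‖h‖ ^ 2 / η * ‖w‖ ^ 2 - 2 * (‖c‖ * (‖h‖ * ‖w‖)) := by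
    field_simp; ring
  linarith

/-- The difference solves the system at `z₀` with source proportional to `(z - z₀)(a, b)`. Its first
component vanishes at `0`, so the boundary term in the energy identity is `|b(0) - b₀(0)|² ≥ 0`.
Young's inequality absorbs half of the dissipation, and the rest of the source is controlled by
`integral_sq_le`. -/
lemma integral_sub_sq_le (h : IsWeylPair v z a b) (h₀ : IsWeylPair v z₀ a₀ b₀)
    (hz : 0 < z.im) (hz₀ : 0 < z₀.im) (ha : a 0 = 1) (ha₀ : a₀ 0 = 1) :
    ∫ x in Ioi 0, (‖a x - a₀ x‖ ^ 2 + ‖b x - b₀ x‖ ^ 2) ≤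
      ‖z - z₀‖ ^ 2 / (z₀.im ^ 2 * (2 * z.im)) := by
  obtain ⟨i1, i2⟩ := h.integrable_sub_sq h₀
  have hN := h.integral_sq_le hz
  rw [ha] at hN
  set F' : ℝ → ℝ := fun x => (-2 * z₀.im * (‖a x - a₀ x‖ ^ 2 + ‖b x - b₀ x‖ ^ 2) +
        2 * (inner ℝ (a x - a₀ x) (Complex.I * ((z - z₀) * a x)) +
          inner ℝ (b x - b₀ x) (Complex.I * ((z - z₀) * b x)))) with hF'
  have c1 := h.continuousOn_fst
  have c2 := h.continuousOn_snd
  have c3 := h₀.continuousOn_fst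
  have c4 := h₀.continuousOn_snd
  have hcont : ContinuousOn F' (Ici 0) := by
    rw [hF']; fun_prop
  have hin : ∀ c h w : ℂ, |inner ℝ c (Complex.I * (h * w))| ≤ ‖c‖ ^ 2 + ‖h‖ ^ 2 * ‖w‖ ^ 2 := by
    intro c h w
    refine (abs_inner_I_mul_mul_le c h w).trans ?_
    nlinarith [sq_nonneg (‖c‖ - ‖h‖ * ‖w‖), sq_nonneg (‖c‖), sq_nonneg (‖h‖ * ‖w‖)]
  have hFint : IntegrableOn F' (Ioi 0) := by
    refine Integrable.mono' (((i1.add i2).const_mul (2 * z₀.im)).add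
      (((i1.add i2).add (h.integrable_sq.const_mul (‖z - z₀‖ ^ 2))).const_mul 2))
      ((hcont.mono Ioi_subset_Ici_self).aestronglyMeasurable measurableSet_Ioi)
      (Eventually.of_forall fun x => ?_)
    rw [hF', Real.norm_eq_abs]
    refine (abs_add_le _ _).trans ?_
    simp only [Pi.add_apply]
    refine add_le_add (le_of_eq ?_) ?_
    · rw [abs_mul, abs_of_nonneg (by positivity : 0 ≤ ‖a x - a₀ x‖ ^ 2 + ‖b x - b₀ x‖ ^ 2),
        abs_mul, abs_of_pos hz₀]
      norm_num
    · rw [abs_mul, abs_two]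
      refine mul_le_mul_of_nonneg_left ?_ two_pos.le
      refine (abs_add_le _ _).trans ?_
      have e1 := hin (a x - a₀ x) (z - z₀) (a x)
      have e2 := hin (b x - b₀ x) (z - z₀) (b x)
      nlinarith
  have h1 : ∫ x in Ioi 0, F' x = -(‖a 0 - a₀ 0‖ ^ 2 - ‖b 0 - b₀ 0‖ ^ 2) :=
    integral_Ioi_deriv_eq_neg (fun x hx => h.hasDerivWithinAt_norm_sq_sub_difference h₀ hx)
      (i1.sub i2) hFint
  have h2 : ∫ x in Ioi 0, F' x ≤ ∫ x in Ioi 0,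
      (-z₀.im * (‖a x - a₀ x‖ ^ 2 + ‖b x - b₀ x‖ ^ 2) +
        ‖z - z₀‖ ^ 2 / z₀.im * (‖a x‖ ^ 2 + ‖b x‖ ^ 2)) := by
    refine integral_mono hFint (((i1.add i2).const_mul _).add (h.integrable_sq.const_mul _))
      fun x => ?_
    have e1 := two_mul_inner_le hz₀ (a x - a₀ x) (z - z₀) (a x)
    have e2 := two_mul_inner_le hz₀ (b x - b₀ x) (z - z₀) (b x)
    simp only [hF']
    nlinarith
  have i12 : IntegrableOn (fun x => ‖a x - a₀ x‖ ^ 2 + ‖b x - b₀ x‖ ^ 2) (Ioi 0) := i1.add i2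
  rw [h1, integral_add (i12.const_mul _) (h.integrable_sq.const_mul _),
    integral_const_mul, integral_const_mul, ha, ha₀] at h2
  set S := ∫ x in Ioi 0, (‖a x - a₀ x‖ ^ 2 + ‖b x - b₀ x‖ ^ 2)
  have h3 : ‖z - z₀‖ ^ 2 / z₀.im * (∫ x in Ioi 0, (‖a x‖ ^ 2 + ‖b x‖ ^ 2)) ≤
      ‖z - z₀‖ ^ 2 / z₀.im * (‖(1 : ℂ)‖ ^ 2 / (2 * z.im)) := by gcongr
  have h4 : z₀.im * S ≤ ‖z - z₀‖ ^ 2 / z₀.im * (‖(1 : ℂ)‖ ^ 2 / (2 * z.im)) := by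
    simp only [sub_self, norm_zero] at h2
    nlinarith [sq_nonneg ‖b 0 - b₀ 0‖]
  rw [le_div_iff₀ (by positivity)]
  have h5 := mul_le_mul_of_nonneg_right h4 (by positivity : 0 ≤ z₀.im * (2 * z.im))
  have h6 : ‖z - z₀‖ ^ 2 / z₀.im * (‖(1 : ℂ)‖ ^ 2 / (2 * z.im)) * (z₀.im * (2 * z.im)) =
      ‖z - z₀‖ ^ 2 := by
    simp; field_simp
  nlinarith

/-- Quantitative complex differentiability of the Weyl function in the spectral parameter. -/
lemma norm_snd_sub_sub_le (h : IsWeylPair v z a b) (h₀ : IsWeylPair v z₀ a₀ b₀)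
    (hz : 0 < z.im) (hz₀ : 0 < z₀.im) (ha : a 0 = 1) (ha₀ : a₀ 0 = 1) :
    ‖b 0 - b₀ 0 - (z - z₀) * (2 * Complex.I * ∫ x in Ioi 0, a₀ x * b₀ x)‖ ≤
      (1 / (z₀.im ^ 2 * (2 * z.im)) + 1 / (2 * z₀.im)) * ‖z - z₀‖ ^ 2 := by
  obtain ⟨i1, i2⟩ := h.integrable_sub_sq h₀
  have hS := h.integral_sub_sq_le h₀ hz hz₀ ha ha₀
  have hN := h₀.integral_sq_le hz₀
  rw [ha₀] at hN
  have c1 := h.continuousOn_fst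
  have c2 := h.continuousOn_snd
  have c3 := h₀.continuousOn_fst
  have c4 := h₀.continuousOn_snd
  -- The potential cancels in this Wronskian too. Integrated over the half-line it expresses `b(0) -
  -- b₀(0)` as `i (z - z₀) ∫ (a b₀ + b a₀)`; replacing `(a, b)` by `(a₀, b₀)` there costs only
  -- second order.
  have hW : ∀ x, 0 ≤ x → HasDerivWithinAt (fun x => a x * b₀ x - b x * a₀ x)
      (Complex.I * (z - z₀) * (a x * b₀ x + b x * a₀ x)) (Ici 0) x := by
    intro x hx
    refine (((h.deriv_fst x hx).mul (h₀.deriv_snd x hx)).sub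
      ((h.deriv_snd x hx).mul (h₀.deriv_fst x hx))).congr_deriv ?_
    ring
  have j1 := integrableOn_mul_of_sq c1 c4 h.integrable_fst h₀.integrable_snd
  have j2 := integrableOn_mul_of_sq c2 c3 h.integrable_snd h₀.integrable_fst
  have j3 := integrableOn_mul_of_sq c3 c4 h₀.integrable_fst h₀.integrable_snd
  have j4 : IntegrableOn (fun x => (a x - a₀ x) * b₀ x) (Ioi 0) :=
    integrableOn_mul_of_sq (c1.sub c3) c4 i1 h₀.integrable_snd
  have j5 : IntegrableOn (fun x => (b x - b₀ x) * a₀ x) (Ioi 0) :=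
    integrableOn_mul_of_sq (c2.sub c4) c3 i2 h₀.integrable_fst
  have h1 := integral_Ioi_deriv_eq_neg hW (j1.sub j2) ((j1.add j2).const_mul _)
  rw [integral_const_mul, ha, ha₀] at h1
  have h2 : ∫ x in Ioi 0, (a x * b₀ x + b x * a₀ x) =
      2 * (∫ x in Ioi 0, a₀ x * b₀ x) +
        ∫ x in Ioi 0, ((a x - a₀ x) * b₀ x + (b x - b₀ x) * a₀ x) := by
    have j45 : IntegrableOn (fun x => (a x - a₀ x) * b₀ x + (b x - b₀ x) * a₀ x) (Ioi 0) :=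
      j4.add j5
    rw [← integral_const_mul, ← integral_add (j3.const_mul _) j45]
    refine integral_congr_ae (Eventually.of_forall fun x => ?_)
    simp only; ring
  rw [h2] at h1
  have h3 : b 0 - b₀ 0 - (z - z₀) * (2 * Complex.I * ∫ x in Ioi 0, a₀ x * b₀ x) =
      ∫ x in Ioi 0, (Complex.I * (z - z₀)) * ((a x - a₀ x) * b₀ x + (b x - b₀ x) * a₀ x) := by
    rw [integral_const_mul]
    linear_combination -h1
  rw [h3]
  calc _ ≤ ∫ x in Ioi 0, ((‖a x - a₀ x‖ ^ 2 + ‖b x - b₀ x‖ ^ 2) +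
        ‖z - z₀‖ ^ 2 * (‖a₀ x‖ ^ 2 + ‖b₀ x‖ ^ 2)) := by
        refine norm_integral_le_of_norm_le ((i1.add i2).add (h₀.integrable_sq.const_mul _))
          (Eventually.of_forall fun x => ?_)
        rw [norm_mul, norm_mul, Complex.norm_I, one_mul]
        have e1 := norm_add_le ((a x - a₀ x) * b₀ x) ((b x - b₀ x) * a₀ x)
        rw [norm_mul, norm_mul] at e1
        have e2 := mul_le_mul_of_nonneg_left e1 (norm_nonneg (z - z₀))
        refine e2.trans ?_
        nlinarith [sq_nonneg (‖a x - a₀ x‖ - ‖z - z₀‖ * ‖b₀ x‖),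
          sq_nonneg (‖b x - b₀ x‖ - ‖z - z₀‖ * ‖a₀ x‖),
          sq_nonneg ‖a x - a₀ x‖, sq_nonneg ‖b x - b₀ x‖,
          sq_nonneg (‖z - z₀‖ * ‖b₀ x‖), sq_nonneg (‖z - z₀‖ * ‖a₀ x‖)]
    _ = (∫ x in Ioi 0, (‖a x - a₀ x‖ ^ 2 + ‖b x - b₀ x‖ ^ 2)) +
        ‖z - z₀‖ ^ 2 * ∫ x in Ioi 0, (‖a₀ x‖ ^ 2 + ‖b₀ x‖ ^ 2) := by
        rw [← integral_const_mul]
        exact integral_add (i1.add i2) (h₀.integrable_sq.const_mul _)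
    _ ≤ ‖z - z₀‖ ^ 2 / (z₀.im ^ 2 * (2 * z.im)) +
        ‖z - z₀‖ ^ 2 * (‖(1 : ℂ)‖ ^ 2 / (2 * z₀.im)) := by gcongr
    _ = _ := by simp; ring

end Difference

/-- The Riccati equation of `ψ = b/a`. -/
lemma hasDerivWithinAt_ratio (h : IsWeylPair v z a b) {x : ℝ} (hx : 0 ≤ x) (ha : a x ≠ 0) :
    HasDerivWithinAt (fun x => b x / a x)
      (-Complex.I * (2 * z * (b x / a x) + (starRingEnd ℂ) (v x) + v x * (b x / a x) ^ 2))
      (Ici 0) x := by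
  refine ((h.deriv_snd x hx).div (h.deriv_fst x hx) ha).congr_deriv ?_
  field_simp
  ring

/-- The Weyl function is small at high energies. -/
lemma norm_ratio_le (h : IsWeylPair v z a b) (hz : 0 < z.im)
    (hv : ∀ x, 0 ≤ x → ‖v x‖ ≤ M) (ha : a 0 ≠ 0) {v' : ℝ → ℂ}
    (hv' : ∀ x, 0 ≤ x → HasDerivWithinAt v (v' x) (Ici 0) x) {L M' : ℝ} (hL : 0 ≤ L)
    (hM' : ∀ x ∈ Icc 0 L, ‖v' x‖ ≤ M') :
    ‖b 0 / a 0‖ ≤ Real.exp (-2 * z.im * L) + (2 * M + (M' + 2 * M ^ 2) * L) / ‖z‖ := by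
  have hz0 : z ≠ 0 := by rintro rfl; simp at hz
  have hzn : 0 < ‖z‖ := norm_pos_iff.2 hz0
  have hM : 0 ≤ M := (norm_nonneg _).trans (hv 0 le_rfl)
  set ψ : ℝ → ℂ := fun x => b x / a x with hψ
  set e : ℝ → ℂ := fun x => Complex.exp (2 * Complex.I * z * x) with he
  have hψ1 : ∀ x, 0 ≤ x → ‖ψ x‖ ≤ 1 := fun x hx => by
    rw [hψ]; simp only [norm_div]
    exact div_le_one_of_le₀ (h.norm_snd_le hz hx) (norm_nonneg _)
  have hen : ∀ x, ‖e x‖ = Real.exp (-2 * z.im * x) := fun x => by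
    rw [he]; simp [Complex.norm_exp]
  have he1 : ∀ x, 0 ≤ x → ‖e x‖ ≤ 1 := fun x hx => by
    rw [hen, Real.exp_le_one_iff]
    have := mul_nonneg hz.le hx
    linarith
  -- The factor `e^{2izx}` removes the linear term of the Riccati equation. The `1/(2z)` correction
  -- is one integration by parts: its derivative cancels the remaining bounded term `-i (conj v + v
  -- ψ²)`, so `N'` is `O(1/|z|)`.
  set N : ℝ → ℂ := fun x => e x * (ψ x + ((starRingEnd ℂ) (v x) - v x * ψ x ^ 2) / (2 * z))
    with hN
  set N' : ℝ → ℂ := fun x => e x * (((starRingEnd ℂ) (v' x) - v' x * ψ x ^ 2) / (2 * z) +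
    Complex.I * v x * ψ x * ((starRingEnd ℂ) (v x) + v x * ψ x ^ 2) / z) with hN'
  have hder : ∀ x ∈ Icc 0 L, HasDerivWithinAt N (N' x) (Icc 0 L) x := by
    intro x hx
    refine HasDerivWithinAt.mono ?_ (Icc_subset_Ici_self : Icc 0 L ⊆ Ici 0)
    have d1 := h.hasDerivWithinAt_ratio hx.1 (h.fst_ne_zero hz hv ha hx.1)
    have d2 : HasDerivWithinAt e (e x * (2 * Complex.I * z)) (Ici 0) x := by
      have : HasDerivAt (fun x : ℝ => 2 * Complex.I * z * (x : ℂ)) (2 * Complex.I * z) x := by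
        simpa using (Complex.ofRealCLM.hasDerivAt (x := x)).const_mul (2 * Complex.I * z)
      exact this.cexp.hasDerivWithinAt
    have d3 : HasDerivWithinAt (fun x => (starRingEnd ℂ) (v x)) ((starRingEnd ℂ) (v' x))
        (Ici 0) x := (hv' x hx.1).star
    have d4 := d2.mul (d1.add ((d3.sub ((hv' x hx.1).mul (d1.pow 2))).div_const (2 * z)))
    refine (d4).congr_deriv ?_
    simp only [hN', hψ, Pi.add_apply, Pi.sub_apply, Pi.mul_apply, Pi.pow_apply]
    field_simp
    push_cast
    ring_nf
  have hbound : ∀ x ∈ Ico 0 L, ‖N' x‖ ≤ (M' + 2 * M ^ 2) / ‖z‖ := by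
    intro x hx
    have p1 := hψ1 x hx.1
    have p2 := hv x hx.1
    have p3 := hM' x ⟨hx.1, hx.2.le⟩
    have p5 : ‖ψ x‖ ^ 2 ≤ 1 := pow_le_one₀ (norm_nonneg _) p1
    have q : ∀ w : ℂ, ∀ m : ℝ, ‖w‖ ≤ m → ‖w * ψ x ^ 2‖ ≤ m := fun w m hw => by
      rw [norm_mul, norm_pow]
      exact (mul_le_of_le_one_right (norm_nonneg _) p5).trans hw
    rw [hN']
    simp only [norm_mul]
    refine (mul_le_of_le_one_left (norm_nonneg _) (he1 x hx.1)).trans ?_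
    refine (norm_add_le _ _).trans ?_
    rw [add_div]
    refine add_le_add ?_ ?_
    · rw [norm_div, norm_mul, Complex.norm_two, div_le_div_iff₀ (by positivity) hzn]
      have r1 := norm_sub_le ((starRingEnd ℂ) (v' x)) (v' x * ψ x ^ 2)
      rw [RCLike.norm_conj] at r1
      have r2 := q _ _ p3
      nlinarith
    · rw [norm_div, norm_mul, norm_mul, norm_mul, Complex.norm_I, one_mul]
      have r1 := norm_add_le ((starRingEnd ℂ) (v x)) (v x * ψ x ^ 2)
      rw [RCLike.norm_conj] at r1
      have r2 := q _ _ p2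
      refine div_le_div_of_nonneg_right ?_ hzn.le
      calc ‖v x‖ * ‖ψ x‖ * ‖(starRingEnd ℂ) (v x) + v x * ψ x ^ 2‖ ≤ M * 1 * (M + M) := by
            gcongr
            linarith
        _ = _ := by ring
  have hmv := norm_image_sub_le_of_norm_deriv_le_segment' hder hbound L ⟨hL, le_rfl⟩
  have hnear : ∀ x, 0 ≤ x →
      ‖((starRingEnd ℂ) (v x) - v x * ψ x ^ 2) / (2 * z)‖ ≤ M / ‖z‖ := by
    intro x hx
    rw [norm_div, norm_mul, Complex.norm_two, div_le_div_iff₀ (by positivity) hzn]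
    have r1 := norm_sub_le ((starRingEnd ℂ) (v x)) (v x * ψ x ^ 2)
    rw [RCLike.norm_conj] at r1
    have r2 : ‖v x * ψ x ^ 2‖ ≤ M := by
      rw [norm_mul, norm_pow]
      exact (mul_le_of_le_one_right (norm_nonneg _)
        (pow_le_one₀ (norm_nonneg _) (hψ1 x hx))).trans (hv x hx)
    have := hv x hx
    nlinarith
  have hNL : ‖N L‖ ≤ Real.exp (-2 * z.im * L) + M / ‖z‖ := by
    rw [hN]; simp only
    rw [mul_add]
    refine (norm_add_le _ _).trans (add_le_add ?_ ?_)
    · rw [norm_mul, hen]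
      exact mul_le_of_le_one_right (Real.exp_pos _).le (hψ1 L hL)
    · rw [norm_mul]
      exact (mul_le_of_le_one_left (norm_nonneg _) (he1 L hL)).trans (hnear L hL)
  have hN0 : N 0 = ψ 0 + ((starRingEnd ℂ) (v 0) - v 0 * ψ 0 ^ 2) / (2 * z) := by
    rw [hN, he]; simp
  -- Go from `0` to `L` by the mean value inequality; at `L` the exponential factor makes `ψ(L)`
  -- harmless.
  have hfin : ‖ψ 0‖ ≤ ‖N L - N 0‖ + ‖N L‖ +
      ‖((starRingEnd ℂ) (v 0) - v 0 * ψ 0 ^ 2) / (2 * z)‖ := by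
    have : ψ 0 = -(N L - N 0) + N L - ((starRingEnd ℂ) (v 0) - v 0 * ψ 0 ^ 2) / (2 * z) := by
      rw [hN0]; ring
    conv_lhs => rw [this]
    refine (norm_sub_le _ _).trans (add_le_add_left ((norm_add_le _ _).trans ?_) _)
    rw [norm_neg]
  have h0 := hnear 0 le_rfl
  have : (2 * M + (M' + 2 * M ^ 2) * L) / ‖z‖ =
      (M' + 2 * M ^ 2) / ‖z‖ * (L - 0) + M / ‖z‖ + M / ‖z‖ := by ring
  rw [this]
  linarith

end IsWeylPair

/-! ### Holomorphy and uniform bounds over the upper half-plane. -/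

/-- The open upper half-plane, as a subset of `ℂ`. -/
def upperPlane : Set ℂ := {z | 0 < z.im}

lemma isOpen_upperPlane : IsOpen upperPlane := isOpen_lt continuous_const Complex.continuous_im

/-- A bounded integrand that is holomorphic in the parameter has a holomorphic integral. -/
lemma differentiableOn_intervalIntegral_of_bounded {U : Set ℂ} (hU : IsOpen U)
    {F : ℂ → ℝ → ℂ} {B : ℝ} (hF : ∀ t, DifferentiableOn ℂ (fun z => F z t) U)
    (hc : ∀ z ∈ U, Continuous (F z)) (hB : ∀ z ∈ U, ∀ t, ‖F z t‖ ≤ B) (c d : ℝ) :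
    DifferentiableOn ℂ (fun z => ∫ t in c..d, F z t) U := by
  intro z₀ hz₀
  obtain ⟨R, hR, hRU⟩ := Metric.isOpen_iff.1 hU z₀ hz₀
  have hd : ∀ z ∈ U, ∀ t, HasDerivAt (fun z => F z t) (deriv (fun z => F z t) z) z :=
    fun z hz t => ((hF t).differentiableAt (hU.mem_nhds hz)).hasDerivAt
  have hsub : ∀ z ∈ Metric.ball z₀ (R / 2), Metric.closedBall z (R / 4) ⊆ U := by
    intro z hz w hw
    refine hRU ?_
    rw [Metric.mem_ball] at *
    rw [Metric.mem_closedBall] at hw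
    linarith [dist_triangle w z z₀]
  have hnhds : Metric.ball z₀ (R / 2) ∈ 𝓝 z₀ := Metric.ball_mem_nhds _ (by positivity)
  refine DifferentiableAt.differentiableWithinAt (HasDerivAt.differentiableAt
    (intervalIntegral.hasDerivAt_integral_of_dominated_loc_of_deriv_le
    (F' := fun z t => deriv (fun z => F z t) z) (bound := fun _ => B / (R / 4))
    hnhds ?_ ((hc z₀ hz₀).intervalIntegrable _ _) ?_ ?_ intervalIntegrable_const ?_).2)
  · filter_upwards [hU.mem_nhds hz₀] with z hz
    exact (hc z hz).aestronglyMeasurable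
  · classical
    -- The `z`-derivative is measurable in `t` as a limit of difference quotients. They are set to
    -- `0` off `U`, where nothing is known about the integrand as a function of `t`.
    refine aestronglyMeasurable_of_tendsto_ae (𝓝[≠] z₀)
      (f := fun w t => if w ∈ U then slope (fun z => F z t) z₀ w else 0) (fun w => ?_)
      (Eventually.of_forall fun t => ?_)
    · by_cases hw : w ∈ U
      · simp only [hw, if_true, slope_def_field]
        exact (((hc w hw).sub (hc z₀ hz₀)).div_const _).aestronglyMeasurable
      · simp only [hw, if_false]
        exact aestronglyMeasurable_const
    · refine (hd z₀ hz₀ t).tendsto_slope.congr' ?_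
      filter_upwards [mem_nhdsWithin_of_mem_nhds (hU.mem_nhds hz₀)] with w hw
      simp [hw]
  · refine Eventually.of_forall fun t _ z hz => ?_
    -- Cauchy's estimate on circles of radius `R / 4` turns the bound on `F` into a dominating
    -- constant for its derivative.
    refine Complex.norm_deriv_le_of_forall_mem_sphere_norm_le (by positivity) ?_ fun w hw =>
      hB w (hsub z hz (Metric.sphere_subset_closedBall hw)) t
    refine DifferentiableOn.diffContOnCl ((hF t).mono ?_)
    rw [closure_ball _ (by positivity)]
    exact hsub z hz
  · refine Eventually.of_forall fun t _ z hz => hd z ?_ t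
    exact hsub z hz (Metric.mem_closedBall_self (by positivity))

/-- The normalized Weyl solutions for all spectral parameters in the upper half-plane. -/
structure IsWeylFamily (v : ℝ → ℂ) (a b : ℂ → ℝ → ℂ) : Prop where
  pair : ∀ z, 0 < z.im → IsWeylPair v z (a z) (b z)
  normalized : ∀ z, 0 < z.im → a z 0 = 1

namespace IsWeylFamily

variable {v : ℝ → ℂ} {a b : ℂ → ℝ → ℂ} {M : ℝ}

lemma fst_ne_zero (h : IsWeylFamily v a b) (hv : ∀ x, 0 ≤ x → ‖v x‖ ≤ M) {z : ℂ}
    (hz : 0 < z.im) {x : ℝ} (hx : 0 ≤ x) : a z x ≠ 0 :=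
  (h.pair z hz).fst_ne_zero hz hv (by simp [h.normalized z hz]) hx

/-- By `norm_snd_sub_sub_le`, the remainder of the first-order expansion is quadratic, uniformly for
`Im z > Im z₀ / 2`. -/
lemma differentiableOn_snd_zero (h : IsWeylFamily v a b) :
    DifferentiableOn ℂ (fun z => b z 0) upperPlane := by
  intro z₀ hz₀
  have hz₀' : 0 < z₀.im := hz₀
  refine (HasDerivAt.differentiableAt (f' := 2 * Complex.I * ∫ x in Ioi 0, a z₀ x * b z₀ x)
    ?_).differentiableWithinAt
  rw [hasDerivAt_iff_isLittleO]
  refine Asymptotics.IsBigO.trans_isLittleO ?_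
    (Asymptotics.isLittleO_pow_sub_sub z₀ (one_lt_two))
  refine Asymptotics.IsBigO.of_bound (1 / (z₀.im ^ 2 * z₀.im) + 1 / (2 * z₀.im)) ?_
  have hev : ∀ᶠ z in 𝓝 z₀, z₀.im / 2 < z.im :=
    Complex.continuous_im.continuousAt.eventually_const_lt (by linarith)
  filter_upwards [hev] with z hz
  have hz' : 0 < z.im := by linarith
  have := (h.pair z hz').norm_snd_sub_sub_le (h.pair z₀ hz₀') hz' hz₀' (h.normalized z hz')
    (h.normalized z₀ hz₀')
  rw [smul_eq_mul]
  refine this.trans ?_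
  rw [norm_pow, norm_norm]
  gcongr
  linarith

lemma shift (h : IsWeylFamily v a b) (hv : ∀ x, 0 ≤ x → ‖v x‖ ≤ M) {y : ℝ} (hy : 0 ≤ y) :
    IsWeylFamily (fun x => v (y + x)) (fun z x => (a z y)⁻¹ * a z (y + x))
      (fun z x => (a z y)⁻¹ * b z (y + x)) where
  pair z hz := ((h.pair z hz).shift hy).const_mul _
  normalized z hz := by
    rw [add_zero, inv_mul_cancel₀ (h.fst_ne_zero hv hz hy)]

/-- A translated Weyl solution, divided by `a(y)`, is the normalized Weyl solution of the translated
potential. The value of `b/a` at `x` is thus a boundary value at `0`, where holomorphy is known. -/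
lemma differentiableOn_ratio (h : IsWeylFamily v a b) (hv : ∀ x, 0 ≤ x → ‖v x‖ ≤ M) {x : ℝ}
    (hx : 0 ≤ x) : DifferentiableOn ℂ (fun z => b z x / a z x) upperPlane := by
  refine (h.shift hv hx).differentiableOn_snd_zero.congr fun z _ => ?_
  rw [add_zero, div_eq_inv_mul]

lemma norm_ratio_le_one (h : IsWeylFamily v a b) {z : ℂ} (hz : 0 < z.im) {x : ℝ} (hx : 0 ≤ x) :
    ‖b z x / a z x‖ ≤ 1 := by
  rw [norm_div]
  exact div_le_one_of_le₀ ((h.pair z hz).norm_snd_le hz hx) (norm_nonneg _)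

lemma continuous_mul_ratio (h : IsWeylFamily v a b) (hv : ∀ x, 0 ≤ x → ‖v x‖ ≤ M)
    (hvc : ContinuousOn v (Ici 0)) {z : ℂ} (hz : 0 < z.im) :
    Continuous fun t : ℝ => v (max t 0) * (b z (max t 0) / a z (max t 0)) := by
  have hmax : Continuous fun t : ℝ => max t 0 := continuous_id.max continuous_const
  have : ContinuousOn (fun t => v t * (b z t / a z t)) (Ici 0) :=
    hvc.mul ((h.pair z hz).continuousOn_snd.div (h.pair z hz).continuousOn_fst
      fun t ht => h.fst_ne_zero hv hz ht)
  exact this.comp_continuous hmax fun t => mem_Ici.2 (le_max_right _ _)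

/-- The logarithmic derivative of `a` is `i (z + v b/a)`. The `max t 0` only extends the integrand
continuously to all of `ℝ`. -/
lemma fst_eq_exp (h : IsWeylFamily v a b) (hv : ∀ x, 0 ≤ x → ‖v x‖ ≤ M)
    (hvc : ContinuousOn v (Ici 0)) {z : ℂ} (hz : 0 < z.im) {x : ℝ} (hx : 0 ≤ x) :
    a z x = Complex.exp (Complex.I * (z * x +
      ∫ t in (0 : ℝ)..x, v (max t 0) * (b z (max t 0) / a z (max t 0)))) := by
  set g : ℝ → ℂ := fun t => v (max t 0) * (b z (max t 0) / a z (max t 0)) with hg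
  have hgc : Continuous g := h.continuous_mul_ratio hv hvc hz
  set E : ℝ → ℂ := fun x => Complex.I * (z * x + ∫ t in (0 : ℝ)..x, g t) with hE
  have hEd : ∀ x, HasDerivAt E (Complex.I * (z + g x)) x := by
    intro x
    have h1 : HasDerivAt (fun x : ℝ => z * (x : ℂ)) z x := by
      simpa using (Complex.ofRealCLM.hasDerivAt (x := x)).const_mul z
    exact (h1.add (hgc.integral_hasStrictDerivAt 0 x).hasDerivAt).const_mul _
  have hd : ∀ y, 0 ≤ y → HasDerivWithinAt (fun x => a z x * Complex.exp (-E x)) 0 (Ici 0) y := by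
    intro y hy
    have ha := h.fst_ne_zero hv hz hy
    refine (((h.pair z hz).deriv_fst y hy).mul
      ((hEd y).neg.cexp).hasDerivWithinAt).congr_deriv ?_
    simp only [hg, max_eq_left hy]
    field_simp
    ring
  have hconst := constant_of_has_deriv_right_zero
    (f := fun x => a z x * Complex.exp (-E x)) (a := 0) (b := x)
    ((continuousOn_of_hasDerivWithinAt hd).mono Icc_subset_Ici_self)
    (fun y hy => (hd y hy.1).mono (Ici_subset_Ici.2 hy.1)) x ⟨hx, le_rfl⟩
  have hE0 : E 0 = 0 := by simp [hE]
  rw [hE0, h.normalized z hz, neg_zero, Complex.exp_zero, mul_one, Complex.exp_neg,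
    mul_inv_eq_one₀ (Complex.exp_ne_zero _)] at hconst
  exact hconst

lemma differentiableOn_fst (h : IsWeylFamily v a b) (hv : ∀ x, 0 ≤ x → ‖v x‖ ≤ M)
    (hvc : ContinuousOn v (Ici 0)) {x : ℝ} (hx : 0 ≤ x) :
    DifferentiableOn ℂ (fun z => a z x) upperPlane := by
  have h1 : DifferentiableOn ℂ (fun z => ∫ t in (0 : ℝ)..x,
      v (max t 0) * (b z (max t 0) / a z (max t 0))) upperPlane := by
    refine differentiableOn_intervalIntegral_of_bounded isOpen_upperPlane (B := M)
      (fun t => (h.differentiableOn_ratio hv (le_max_right _ _)).const_mul _)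
      (fun z hz => h.continuous_mul_ratio hv hvc hz) (fun z hz t => ?_) 0 x
    rw [norm_mul]
    exact (mul_le_of_le_one_right (norm_nonneg _)
      (h.norm_ratio_le_one hz (le_max_right _ _))).trans (hv _ (le_max_right _ _))
  refine DifferentiableOn.congr (DifferentiableOn.cexp (DifferentiableOn.const_mul
    ((differentiableOn_id.mul_const (x : ℂ)).add h1) Complex.I)) fun z hz => ?_
  exact h.fst_eq_exp hv hvc hz hx

lemma differentiableOn_snd (h : IsWeylFamily v a b) (hv : ∀ x, 0 ≤ x → ‖v x‖ ≤ M)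
    (hvc : ContinuousOn v (Ici 0)) {x : ℝ} (hx : 0 ≤ x) :
    DifferentiableOn ℂ (fun z => b z x) upperPlane := by
  refine ((h.differentiableOn_ratio hv hx).mul (h.differentiableOn_fst hv hvc hx)).congr
    fun z hz => ?_
  exact (div_mul_cancel₀ _ (h.fst_ne_zero hv hz hx)).symm

/-- The Weyl function stays away from `1` on every half-plane `η ≤ Im z`. -/
lemma exists_norm_inv_one_sub_le (h : IsWeylFamily v a b) (hv : ∀ x, 0 ≤ x → ‖v x‖ ≤ M)
    {v' : ℝ → ℂ} (hv' : ∀ x, 0 ≤ x → HasDerivWithinAt v (v' x) (Ici 0) x)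
    (hvc' : ContinuousOn v' (Ici 0)) (hne : ∀ z : ℂ, 0 < z.im → 1 - b z 0 ≠ 0)
    {η : ℝ} (hη : 0 < η) :
    ∃ B, ∀ z : ℂ, η ≤ z.im → ‖(1 - b z 0)⁻¹‖ ≤ B := by
  set L : ℝ := 1 / η with hL
  have hL0 : 0 < L := by positivity
  -- Only `v` is bounded on the whole half-line; for `v'` a bound on `[0, L]` has to suffice.
  obtain ⟨M', hM'⟩ := (isCompact_Icc (a := (0 : ℝ)) (b := L)).exists_bound_of_continuousOn
    (hvc'.mono Icc_subset_Ici_self)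
  -- `L = 1/η` makes the exponential term of `norm_ratio_le` at most `e⁻² ≤ 1/4`, and `R` makes the
  -- other term at most `1/4`, so `|b(0)| ≤ 1/2` outside the disc.
  set R : ℝ := 4 * |2 * M + (M' + 2 * M ^ 2) * L| + 1 with hR
  have hR0 : 0 < R := by positivity
  have hlarge : ∀ z : ℂ, η ≤ z.im → R ≤ ‖z‖ → ‖(1 - b z 0)⁻¹‖ ≤ 2 := by
    intro z hz hzR
    have hz0 : 0 < z.im := hη.trans_le hz
    have hle := (h.pair z hz0).norm_ratio_le hz0 hv (by simp [h.normalized z hz0]) hv'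
      hL0.le hM'
    rw [h.normalized z hz0, div_one] at hle
    have e1 : Real.exp (-2 * z.im * L) ≤ 1 / 4 := by
      have : Real.exp (-2 * z.im * L) ≤ Real.exp (-2) := by
        rw [Real.exp_le_exp]
        have : 1 ≤ z.im * L := by
          rw [hL, mul_one_div, le_div_iff₀ hη, one_mul]; exact hz
        linarith
      refine this.trans ?_
      rw [Real.exp_neg, one_div]
      gcongr
      have h2 := Real.add_one_le_exp (1 : ℝ)
      have h3 : Real.exp 2 = Real.exp 1 * Real.exp 1 := by rw [← Real.exp_add]; norm_num
      nlinarith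
    have e2 : (2 * M + (M' + 2 * M ^ 2) * L) / ‖z‖ ≤ 1 / 4 := by
      rw [div_le_div_iff₀ (hR0.trans_le hzR) (by norm_num)]
      have := le_abs_self (2 * M + (M' + 2 * M ^ 2) * L)
      linarith
    have e3 : 1 / 2 ≤ ‖1 - b z 0‖ := by
      have := norm_sub_norm_le 1 (b z 0)
      rw [norm_one] at this
      linarith
    rw [norm_inv]
    exact inv_le_of_inv_le₀ (by norm_num) (by linarith)
  have hK : IsCompact ({z : ℂ | η ≤ z.im} ∩ Metric.closedBall 0 R) :=
    (isCompact_closedBall _ _).inter_left (isClosed_le continuous_const Complex.continuous_im)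
  obtain ⟨B, hB⟩ := hK.exists_bound_of_continuousOn (f := fun z => (1 - b z 0)⁻¹) (by
    refine ContinuousOn.inv₀ (continuousOn_const.sub
      (h.differentiableOn_snd_zero.continuousOn.mono ?_)) ?_
    · exact fun z hz => hη.trans_le hz.1
    · exact fun z hz => hne z (hη.trans_le hz.1))
  refine ⟨max B 2, fun z hz => ?_⟩
  rcases le_total R ‖z‖ with hR | hR
  · exact (hlarge z hz hR).trans (le_max_right _ _)
  · exact (hB z ⟨hz, by simpa using hR⟩).trans (le_max_left _ _)

end IsWeylFamily

/-! ### From the Herglotz Weyl function to normalized Weyl solutions. -/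

/-- The initial value `k = K*[1; -iφ]` satisfies `k₀ - k₁ = 2c ≠ 0`, and the cone gives `|k₁| ≤
|k₀|`, so `k₀ ≠ 0`. Dividing by `k₀` and solving for `φ` yields the Cayley transform of `b(0)`. The
hypothesis treats each `z` separately; regularity of `φ` in `z` comes from this formula. -/
lemma IsHerglotzWeyl.exists_isWeylFamily {v : ℝ → ℂ} {φ : ℂ → ℂ} (hφ : IsHerglotzWeyl v φ) :
    ∃ a b : ℂ → ℝ → ℂ, IsWeylFamily v a b ∧
      ∀ z, 0 < z.im → 1 - b z 0 ≠ 0 ∧ φ z = Complex.I * (1 + b z 0) / (1 - b z 0) := by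
  have key : ∀ z : ℂ, 0 < z.im → ∃ a b : ℝ → ℂ, IsWeylPair v z a b ∧ a 0 = 1 ∧
      1 - b 0 ≠ 0 ∧ φ z = Complex.I * (1 + b 0) / (1 - b 0) := by
    intro z hz
    obtain ⟨Y, hY, hint⟩ := hφ z hz
    set k : Fin 2 → ℂ := Kᴴ *ᵥ ![1, -Complex.I * φ z] with hk
    set w : Fin 2 → ℝ → ℂ := fun i x => (Y x *ᵥ k) i with hw
    have hws : ∀ i x, w i x = Y x i 0 * k 0 + Y x i 1 * k 1 := fun i x => by
      simp [hw, Matrix.mulVec, dotProduct, Fin.sum_univ_two]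
    have hpair : IsWeylPair v z (w 0) (w 1) := by
      have hd : ∀ i x, 0 ≤ x → HasDerivWithinAt (w i)
          (((Complex.I • (z • jMat + jMat * specPotential v x)) * Y x) i 0 * k 0 +
            ((Complex.I • (z • jMat + jMat * specPotential v x)) * Y x) i 1 * k 1)
          (Ici 0) x := by
        intro i x hx
        have e : w i = fun x => Y x i 0 * k 0 + Y x i 1 * k 1 := funext (hws i)
        rw [e]
        exact ((hY.ode x hx i 0).mul_const _).add ((hY.ode x hx i 1).mul_const _)
      refine ⟨fun x hx => (hd 0 x hx).congr_deriv ?_, fun x hx => (hd 1 x hx).congr_deriv ?_, ?_⟩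
      · simp [hws, jMat, specPotential, Matrix.mul_apply, Fin.sum_univ_two]
        ring
      · simp [hws, jMat, specPotential, Matrix.mul_apply, Fin.sum_univ_two]
        ring
      · have := hint.re
        refine this.congr (Eventually.of_forall fun x => ?_)
        simp only [Complex.sq_norm, Complex.normSq_apply]
        simp [hw, dotProduct, Fin.sum_univ_two, Complex.mul_re]
        ring
    have hw0 : ∀ i, w i 0 = k i := fun i => by simp only [hw, hY.normalized, Matrix.one_mulVec]
    set c : ℂ := ((1 / Real.sqrt 2 : ℝ) : ℂ) with hc
    have hc0 : c ≠ 0 := by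
      rw [hc, Complex.ofReal_ne_zero]; positivity
    have hcc : (starRingEnd ℂ) c = c := Complex.conj_ofReal _
    have hk0 : k 0 = c * (1 - Complex.I * φ z) := by
      simp [hk, K, ← hc, Matrix.conjTranspose_apply, hcc, -one_div, -Complex.ofReal_div]
      ring
    have hk1 : k 1 = c * (-1 - Complex.I * φ z) := by
      simp [hk, K, ← hc, Matrix.conjTranspose_apply, hcc, -one_div, -Complex.ofReal_div]
      ring
    have hle := hpair.norm_snd_le hz (le_refl 0)
    rw [hw0, hw0] at hle
    have hsub : k 0 - k 1 = 2 * c := by rw [hk0, hk1]; ring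
    have hk0ne : k 0 ≠ 0 := by
      intro h0
      rw [h0, norm_zero, norm_le_zero_iff] at hle
      rw [h0, hle, sub_zero] at hsub
      exact hc0 (by simpa using hsub.symm)
    have hrat : 1 - (k 0)⁻¹ * k 1 = 2 * c / k 0 := by
      rw [← hsub]; field_simp
    refine ⟨fun x => (k 0)⁻¹ * w 0 x, fun x => (k 0)⁻¹ * w 1 x, hpair.const_mul _, ?_, ?_, ?_⟩
    · simp only [hw0]
      rw [inv_mul_cancel₀ hk0ne]
    · simp only [hw0]
      rw [hrat]
      exact div_ne_zero (mul_ne_zero two_ne_zero hc0) hk0ne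
    · simp only [hw0]
      rw [hrat]
      have : 1 + (k 0)⁻¹ * k 1 = -2 * c * Complex.I * φ z / k 0 := by
        field_simp
        rw [hk0, hk1]; ring
      rw [this]
      field_simp
      rw [Complex.I_sq]; ring
  choose! a b h1 h2 h3 using key
  exact ⟨a, b, ⟨h1, h2⟩, h3⟩

/-- The Weyl solutions of `J y' + (z + 𝒱) y = 0` normalized by `y(0) = (1, φ(z))`, together with
the bounds that make their Laplace inversion absolutely convergent. -/
structure IsNormalizedWeylFamily (p q : ℝ → ℝ) (φ : ℂ → ℂ) (M : ℝ) (Φ₁ Φ₂ : ℂ → ℝ → ℂ) :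
    Prop where
  deriv_fst : ∀ z : ℂ, 0 < z.im → ∀ x, 0 ≤ x →
    HasDerivWithinAt (Φ₁ z) (q x * Φ₁ z x + (z - p x) * Φ₂ z x) (Ici 0) x
  deriv_snd : ∀ z : ℂ, 0 < z.im → ∀ x, 0 ≤ x →
    HasDerivWithinAt (Φ₂ z) (-(z + p x) * Φ₁ z x - q x * Φ₂ z x) (Ici 0) x
  fst_zero : ∀ z : ℂ, 0 < z.im → Φ₁ z 0 = 1
  snd_zero : ∀ z : ℂ, 0 < z.im → Φ₂ z 0 = φ z
  differentiableOn_fst : ∀ x, 0 ≤ x → DifferentiableOn ℂ (fun z => Φ₁ z x) upperPlane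
  differentiableOn_snd : ∀ x, 0 ≤ x → DifferentiableOn ℂ (fun z => Φ₂ z x) upperPlane
  bound : ∀ η : ℝ, 0 < η → ∃ B, 0 ≤ B ∧ ∀ z : ℂ, η ≤ z.im → ∀ x, 0 ≤ x →
    ‖Φ₁ z x‖ ≤ B * Real.exp ((M - z.im) * x) ∧ ‖Φ₂ z x‖ ≤ B * Real.exp ((M - z.im) * x)

/-- The combinations `a - b` and `i (a + b)` turn the spectral system into `J y' + (z + 𝒱) y = 0`;
the factor `(1 - b(0))⁻¹` then produces the initial value `(1, φ)`. -/
theorem IsHerglotzWeyl.exists_isNormalizedWeylFamily {p q : ℝ → ℝ}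
    (hp : ContDiffOn ℝ 1 p (Ici 0)) (hq : ContDiffOn ℝ 1 q (Ici 0))
    (hV : ∃ C : ℝ, ∀ x : ℝ, 0 ≤ x → |p x| ≤ C ∧ |q x| ≤ C)
    {φ : ℂ → ℂ} (hφ : IsHerglotzWeyl (assocV p q) φ) :
    ∃ M Φ₁ Φ₂, 0 ≤ M ∧ IsNormalizedWeylFamily p q φ M Φ₁ Φ₂ := by
  obtain ⟨C, hC⟩ := hV
  obtain ⟨a, b, h, hb⟩ := hφ.exists_isWeylFamily
  have hC0 : 0 ≤ C := (abs_nonneg _).trans (hC 0 le_rfl).1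
  have hv : ∀ x, 0 ≤ x → ‖assocV p q x‖ ≤ 2 * C := by
    intro x hx
    refine (norm_sub_le _ _).trans ?_
    simp only [norm_mul, Complex.norm_I, one_mul, Complex.norm_real, Real.norm_eq_abs]
    linarith [(hC x hx).1, (hC x hx).2]
  have hd : ∀ f : ℝ → ℝ, ContDiffOn ℝ 1 f (Ici 0) →
      (∀ x, 0 ≤ x → HasDerivWithinAt (fun x => (f x : ℂ)) ((derivWithin f (Ici 0) x : ℝ) : ℂ)
        (Ici 0) x) ∧ ContinuousOn (fun x => ((derivWithin f (Ici 0) x : ℝ) : ℂ)) (Ici 0) := by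
    intro f hf
    refine ⟨fun x hx => ?_, ?_⟩
    · exact ((hf.differentiableOn (by simp)) x hx).hasDerivWithinAt.ofReal_comp
    · exact Complex.continuous_ofReal.comp_continuousOn
        (hf.continuousOn_derivWithin (uniqueDiffOn_Ici 0) le_rfl)
  have hv' : ∀ x, 0 ≤ x → HasDerivWithinAt (assocV p q)
      (Complex.I * ((derivWithin q (Ici 0) x : ℝ) : ℂ) - ((derivWithin p (Ici 0) x : ℝ) : ℂ))
      (Ici 0) x := fun x hx =>
    (((hd q hq).1 x hx).const_mul Complex.I).sub ((hd p hp).1 x hx)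
  have hvc : ContinuousOn (assocV p q) (Ici 0) := continuousOn_of_hasDerivWithinAt hv'
  have hvc' := (continuousOn_const.mul (hd q hq).2 : ContinuousOn
    (fun x => Complex.I * ((derivWithin q (Ici 0) x : ℝ) : ℂ)) (Ici 0)).sub (hd p hp).2
  have hbd : DifferentiableOn ℂ (fun z => (1 - b z 0)⁻¹) upperPlane :=
    (h.differentiableOn_snd_zero.const_sub 1).inv fun z hz => (hb z hz).1
  refine ⟨2 * C, fun z x => (a z x - b z x) * (1 - b z 0)⁻¹,
    fun z x => Complex.I * (a z x + b z x) * (1 - b z 0)⁻¹, by positivity, ?_⟩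
  refine ⟨fun z hz x hx => ?_, fun z hz x hx => ?_, fun z hz => ?_, fun z hz => ?_,
    fun x hx => ?_, fun x hx => ?_, fun η hη => ?_⟩
  · refine ((((h.pair z hz).deriv_fst x hx).sub ((h.pair z hz).deriv_snd x hx)).mul_const
      _).congr_deriv ?_
    simp [assocV]
    ring_nf
    simp only [Complex.I_sq]
    ring
  · refine (((((h.pair z hz).deriv_fst x hx).add ((h.pair z hz).deriv_snd x hx)).const_mul
      Complex.I).mul_const _).congr_deriv ?_
    simp [assocV]
    ring_nf
    simp only [Complex.I_sq, Complex.I_pow_three]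
    ring
  · simp only [h.normalized z hz]
    exact mul_inv_cancel₀ (hb z hz).1
  · simp only [h.normalized z hz]
    rw [(hb z hz).2, div_eq_mul_inv]
  · exact ((h.differentiableOn_fst hv hvc hx).sub (h.differentiableOn_snd hv hvc hx)).mul hbd
  · exact (((h.differentiableOn_fst hv hvc hx).add
      (h.differentiableOn_snd hv hvc hx)).const_mul Complex.I).mul hbd
  · obtain ⟨B, hB⟩ := h.exists_norm_inv_one_sub_le hv hv' hvc' (fun z hz => (hb z hz).1) hη
    have hB0 : 0 ≤ B := (norm_nonneg _).trans
      (hB ((η : ℂ) * Complex.I) (by simp))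
    refine ⟨2 * B, by positivity, fun z hz x hx => ?_⟩
    have hz0 : 0 < z.im := hη.trans_le hz
    have e1 := (h.pair z hz0).norm_snd_le hz0 hx
    have e2 := (h.pair z hz0).norm_fst_le hz0 hv hx
    rw [h.normalized z hz0, norm_one, one_mul] at e2
    have e3 := hB z hz
    have e4 : ∀ w : ℂ, ‖w‖ ≤ ‖a z x‖ + ‖b z x‖ →
        ‖w * (1 - b z 0)⁻¹‖ ≤ 2 * B * Real.exp ((2 * C - z.im) * x) := by
      intro w hw
      rw [norm_mul]
      calc _ ≤ (2 * Real.exp ((2 * C - z.im) * x)) * B := by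
            gcongr; linarith
        _ = _ := by ring
    refine ⟨e4 _ (norm_sub_le _ _), e4 _ ?_⟩
    rw [norm_mul, Complex.norm_I, one_mul]
    exact norm_add_le _ _

/-! ### Integrals over horizontal lines -/

/-- The point `ξ + i η` of the horizontal line at height `η`. -/
def hline (η ξ : ℝ) : ℂ := (ξ : ℂ) + Complex.I * (η : ℂ)

@[simp] lemma hline_re (η ξ : ℝ) : (hline η ξ).re = ξ := by simp [hline]

@[simp] lemma hline_im (η ξ : ℝ) : (hline η ξ).im = η := by simp [hline]

@[fun_prop] lemma continuous_hline (η : ℝ) : Continuous (hline η) := by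
  unfold hline; fun_prop

lemma norm_hline_sq (η ξ : ℝ) : ‖hline η ξ‖ ^ 2 = ξ ^ 2 + η ^ 2 := by
  rw [Complex.sq_norm, Complex.normSq_apply]; simp; ring

lemma norm_hline_pos {η : ℝ} (hη : 0 < η) (ξ : ℝ) : 0 < ‖hline η ξ‖ := by
  rw [norm_pos_iff]
  intro h
  have := hline_im η ξ
  rw [h] at this
  simp at this
  exact hη.ne this

lemma le_norm_hline {η : ℝ} (ξ : ℝ) : η ≤ ‖hline η ξ‖ := by
  have := Complex.abs_im_le_norm (hline η ξ)
  rw [hline_im] at this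
  exact (le_abs_self _).trans this

lemma inv_norm_hline_sq_le {η : ℝ} (hη : 0 < η) (ξ : ℝ) :
    (‖hline η ξ‖ ^ 2)⁻¹ ≤ max 1 (η ^ 2)⁻¹ * (1 + ξ ^ 2)⁻¹ := by
  have h1 : 1 ≤ max 1 (η ^ 2)⁻¹ := le_max_left _ _
  have h2 : 1 ≤ max 1 (η ^ 2)⁻¹ * η ^ 2 := by
    calc 1 = (η ^ 2)⁻¹ * η ^ 2 := (inv_mul_cancel₀ (by positivity)).symm
      _ ≤ _ := by gcongr; exact le_max_right _ _
  rw [norm_hline_sq, ← div_eq_mul_inv, inv_eq_one_div, div_le_div_iff₀ (by positivity)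
    (by positivity)]
  nlinarith [sq_nonneg ξ]

lemma continuous_inv_norm_hline_sq {η : ℝ} (hη : 0 < η) :
    Continuous fun ξ => (‖hline η ξ‖ ^ 2)⁻¹ :=
  ((continuous_hline η).norm.pow 2).inv₀ fun ξ => (pow_pos (norm_hline_pos hη ξ) 2).ne'

lemma integrable_inv_norm_hline_sq {η : ℝ} (hη : 0 < η) :
    Integrable fun ξ => (‖hline η ξ‖ ^ 2)⁻¹ := by
  refine Integrable.mono' (integrable_inv_one_add_sq.const_mul (max 1 (η ^ 2)⁻¹))
    (continuous_inv_norm_hline_sq hη).aestronglyMeasurable (Eventually.of_forall fun ξ => ?_)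
  rw [Real.norm_of_nonneg (by positivity)]
  exact inv_norm_hline_sq_le hη ξ

lemma integral_inv_norm_hline_sq_le {η : ℝ} (hη : 1 ≤ η) :
    ∫ ξ, (‖hline η ξ‖ ^ 2)⁻¹ ≤ Real.pi := by
  rw [← integral_univ_inv_one_add_sq]
  refine integral_mono (integrable_inv_norm_hline_sq (by linarith)) integrable_inv_one_add_sq
    fun ξ => ?_
  have h := inv_norm_hline_sq_le (by linarith : 0 < η) ξ
  rwa [max_eq_left (inv_le_one_of_one_le₀ (one_le_pow₀ hη)), one_mul] at h

lemma continuous_comp_hline {F : ℂ → ℂ} (hF : DifferentiableOn ℂ F upperPlane) {η : ℝ}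
    (hη : 0 < η) : Continuous fun ξ => F (hline η ξ) :=
  hF.continuousOn.comp_continuous (continuous_hline η) fun ξ => by simpa [upperPlane] using hη

lemma integrable_comp_hline {F : ℂ → ℂ} (hF : DifferentiableOn ℂ F upperPlane) {η B : ℝ}
    (hη : 0 < η) (hB : ∀ z : ℂ, z.im = η → ‖F z‖ ≤ B * (‖z‖ ^ 2)⁻¹) :
    Integrable fun ξ => F (hline η ξ) :=
  Integrable.mono' ((integrable_inv_norm_hline_sq hη).const_mul B)
    (continuous_comp_hline hF hη).aestronglyMeasurable
    (Eventually.of_forall fun ξ => hB _ (hline_im η ξ))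

/-- Shifting the line of integration of a holomorphic function that decays quadratically. -/
lemma integral_hline_eq {F : ℂ → ℂ} (hF : DifferentiableOn ℂ F upperPlane) {η₁ η₂ B : ℝ}
    (h1 : 0 < η₁) (h12 : η₁ ≤ η₂)
    (hB : ∀ z : ℂ, η₁ ≤ z.im → z.im ≤ η₂ → ‖F z‖ ≤ B * (‖z‖ ^ 2)⁻¹) :
    ∫ ξ, F (hline η₁ ξ) = ∫ ξ, F (hline η₂ ξ) := by
  have h2 : 0 < η₂ := h1.trans_le h12
  have hB0 : 0 ≤ B := by
    have h := (norm_nonneg _).trans (hB (hline η₁ 0) (by simp) (by simpa))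
    exact nonneg_of_mul_nonneg_left h (by have := norm_hline_pos h1 0; positivity)
  have i1 := integrable_comp_hline hF h1 fun z hz => hB z hz.ge (hz.trans_le h12)
  have i2 := integrable_comp_hline hF h2 fun z hz => hB z (h12.trans hz.ge) hz.le
  have t1 := intervalIntegral_tendsto_integral i1 tendsto_neg_atTop_atBot tendsto_id
  have t2 := intervalIntegral_tendsto_integral i2 tendsto_neg_atTop_atBot tendsto_id
  have hdiff := t1.sub t2
  have hzero : Tendsto (fun R : ℝ => (∫ ξ in (-R)..(id R), F (hline η₁ ξ)) -
      ∫ ξ in (-R)..(id R), F (hline η₂ ξ)) atTop (𝓝 0) := by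
    have hlim : Tendsto (fun R : ℝ => 2 * (B * (η₂ - η₁)) * (R ^ 2)⁻¹) atTop (𝓝 0) := by
      have : Tendsto (fun R : ℝ => (R ^ 2)⁻¹) atTop (𝓝 0) :=
        tendsto_inv_atTop_zero.comp (tendsto_pow_atTop two_ne_zero)
      simpa using this.const_mul (2 * (B * (η₂ - η₁)))
    refine squeeze_zero_norm' ?_ hlim
    filter_upwards [eventually_gt_atTop 0] with R hR
    have hrect := Complex.integral_boundary_rect_eq_zero_of_differentiableOn F
      ((-R : ℝ) + η₁ * Complex.I) ((R : ℝ) + η₂ * Complex.I) (hF.mono (by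
        intro z hz
        have := hz.2
        simp [uIcc_of_le h12] at this
        exact h1.trans_le this.1))
    simp only [Complex.add_re, Complex.ofReal_re, Complex.mul_re, Complex.I_re, mul_zero,
      Complex.ofReal_im, Complex.I_im, mul_one, sub_self, add_zero, Complex.add_im,
      Complex.mul_im, zero_add] at hrect
    -- On the vertical sides of the rectangle `|z| ≥ R`, so their contribution is `O(R⁻²)`.
    have hside : ∀ r : ℝ, |r| = R →
        ‖∫ y in η₁..η₂, F ((r : ℂ) + y * Complex.I)‖ ≤ B * (R ^ 2)⁻¹ * |η₂ - η₁| := by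
      intro r hr
      refine intervalIntegral.norm_integral_le_of_norm_le_const fun y hy => ?_
      rw [uIoc_of_le h12] at hy
      refine (hB _ (by simpa using hy.1.le) (by simpa using hy.2)).trans ?_
      gcongr
      have := Complex.abs_re_le_norm ((r : ℂ) + y * Complex.I)
      simpa [hr] using this
    have s1 := hside R (abs_of_pos hR)
    have s2 := hside (-R) (by rw [abs_neg, abs_of_pos hR])
    rw [abs_of_nonneg (sub_nonneg.2 h12)] at s1 s2
    have e : ∀ η : ℝ, (∫ ξ in (-R)..R, F (hline η ξ)) =
        ∫ ξ in (-R)..R, F ((ξ : ℂ) + η * Complex.I) := fun η => by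
      simp only [hline, mul_comm Complex.I]
    simp only [id]
    rw [e, e]
    have : (∫ ξ in (-R)..R, F ((ξ : ℂ) + η₁ * Complex.I)) -
        (∫ ξ in (-R)..R, F ((ξ : ℂ) + η₂ * Complex.I)) =
        Complex.I * (∫ y in η₁..η₂, F (((-R : ℝ) : ℂ) + y * Complex.I)) -
        Complex.I * (∫ y in η₁..η₂, F ((R : ℂ) + y * Complex.I)) := by
      simp only [smul_eq_mul] at hrect
      linear_combination hrect
    rw [this]
    refine (norm_sub_le _ _).trans ?_
    rw [norm_mul, norm_mul, Complex.norm_I, one_mul, one_mul]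
    linarith
  exact sub_eq_zero.1 (tendsto_nhds_unique hdiff hzero)

/-! ### Differentiation under the integral sign up to the boundary -/

/-- Dominated convergence is applied to the difference quotients, bounded by the mean value
inequality on `[0, X]`, so that one-sided derivatives at the boundary point `0` are covered. -/
lemma hasDerivWithinAt_integral_Ici {F F' : ℝ → ℝ → ℂ} {bound : ℝ → ℝ} {X x : ℝ}
    (hx : 0 ≤ x) (hxX : x < X) (hint : ∀ y, 0 ≤ y → Integrable (F y))
    (hd : ∀ ξ y, 0 ≤ y → HasDerivWithinAt (fun y => F y ξ) (F' y ξ) (Ici 0) y)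
    (hb : ∀ ξ y, 0 ≤ y → y ≤ X → ‖F' y ξ‖ ≤ bound ξ) (hbound : Integrable bound) :
    HasDerivWithinAt (fun y => ∫ ξ, F y ξ) (∫ ξ, F' x ξ) (Ici 0) x := by
  rw [hasDerivWithinAt_iff_tendsto_slope]
  have hev : ∀ᶠ y in 𝓝[Ici 0 \ {x}] x, 0 ≤ y ∧ y ≤ X := by
    filter_upwards [self_mem_nhdsWithin, mem_nhdsWithin_of_mem_nhds (Iio_mem_nhds hxX)]
      with y h1 h2
    exact ⟨h1.1, le_of_lt h2⟩
  have hslope : ∀ᶠ y in 𝓝[Ici 0 \ {x}] x, (∫ ξ, slope (fun y => F y ξ) x y) =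
      slope (fun y => ∫ ξ, F y ξ) x y := by
    filter_upwards [hev] with y hy
    simp only [slope_def_module]
    rw [integral_smul, integral_sub (hint y hy.1) (hint x hx)]
  refine Tendsto.congr' hslope ?_
  refine tendsto_integral_filter_of_dominated_convergence bound ?_ ?_ hbound ?_
  · filter_upwards [hev] with y hy
    simp only [slope_def_module]
    exact (((hint y hy.1).sub (hint x hx)).smul (y - x)⁻¹).aestronglyMeasurable
  · filter_upwards [hev] with y hy
    refine Eventually.of_forall fun ξ => ?_
    have hmv := Convex.norm_image_sub_le_of_norm_hasDerivWithin_le (𝕜 := ℝ)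
      (f := fun y => F y ξ) (s := Icc 0 X) (x := x) (y := y)
      (fun y hy => (hd ξ y hy.1).mono Icc_subset_Ici_self) (fun y hy => hb ξ y hy.1 hy.2)
      (convex_Icc _ _) ⟨hx, hxX.le⟩ hy
    have hb0 : 0 ≤ bound ξ := (norm_nonneg _).trans (hb ξ x hx hxX.le)
    rw [slope_def_module, norm_smul, norm_inv, inv_mul_eq_div]
    exact div_le_of_le_mul₀ (norm_nonneg _) hb0 hmv
  · exact Eventually.of_forall fun ξ => hasDerivWithinAt_iff_tendsto_slope.1 (hd ξ x hx)

/-! ### The Plancherel identity for integrable functions -/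

section Plancherel

open scoped FourierTransform

lemma continuous_fourier_of_integrable {f : ℝ → ℂ} (hf : Integrable f) : Continuous (𝓕 f) :=
  VectorFourier.fourierIntegral_continuous (L := innerₗ ℝ) Real.continuous_fourierChar
    continuous_inner hf

/-- The `L²` transform and the Fourier integral agree against smooth compactly supported functions:
in both cases the transform moves onto the test function. -/
lemma fourier_toLp_ae_eq {f : ℝ → ℂ} (hf : Integrable f) (hf2 : MemLp f 2) :
    (𝓕 (hf2.toLp f) : Lp ℂ 2 (volume : Measure ℝ)) =ᵐ[volume] 𝓕 f := by
  refine ae_eq_of_integral_contDiff_smul_eq ((Lp.memLp _).locallyIntegrable one_le_two)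
    (continuous_fourier_of_integrable hf).locallyIntegrable fun g hg hgc => ?_
  set G : SchwartzMap ℝ ℂ := HasCompactSupport.toSchwartzMap (f := fun x => (g x : ℂ))
    (hgc.comp_left Complex.ofReal_zero) (Complex.ofRealCLM.contDiff.comp hg) with hG
  have hGa : ∀ x, G x = (g x : ℂ) := fun x => rfl
  have h1 := DFunLike.congr_fun (Lp.fourier_toTemperedDistribution_eq (hf2.toLp f)) G
  rw [TemperedDistribution.fourier_apply, Lp.toTemperedDistribution_apply,
    Lp.toTemperedDistribution_apply] at h1
  have h2 : ∫ x, g x • (𝓕 (hf2.toLp f) : Lp ℂ 2 (volume : Measure ℝ)) x =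
      ∫ x, G x • (𝓕 (hf2.toLp f) : Lp ℂ 2 (volume : Measure ℝ)) x := by
    refine integral_congr_ae (Eventually.of_forall fun x => ?_)
    simp [hGa]
  have h3 : ∫ x, g x • 𝓕 f x = ∫ x, G x • 𝓕 f x := by
    refine integral_congr_ae (Eventually.of_forall fun x => ?_)
    simp [hGa]
  have h4 : ∫ x, (𝓕 G) x • (hf2.toLp f) x = ∫ x, (𝓕 G) x • f x := by
    refine integral_congr_ae ?_
    filter_upwards [hf2.coeFn_toLp] with x hx
    rw [hx]
  have h5 : ∫ x, (𝓕 (G : ℝ → ℂ)) x • f x = ∫ x, G x • 𝓕 f x := by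
    simpa using! VectorFourier.integral_fourierIntegral_smul_eq_flip (L := innerₗ ℝ)
      (μ := volume) (ν := volume) Real.continuous_fourierChar continuous_inner
      (G.integrable (μ := volume)) hf
  rw [h2, h3, ← h1, h4, ← h5, SchwartzMap.fourier_coe]

/-- Plancherel's identity for the Fourier integral of an integrable square integrable function. -/
theorem memLp_fourier_and_eLpNorm_fourier_eq {f : ℝ → ℂ} (hf : Integrable f) (hf2 : MemLp f 2) :
    MemLp (𝓕 f) 2 ∧ eLpNorm (𝓕 f) 2 volume = eLpNorm f 2 volume := by
  have h1 := fourier_toLp_ae_eq hf hf2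
  have h2 : MemLp (𝓕 f) 2 := (memLp_congr_ae h1).1 (Lp.memLp _)
  refine ⟨h2, ?_⟩
  have h3 := Lp.norm_fourier_eq (hf2.toLp f)
  rw [Lp.norm_def, Lp.norm_def, ENNReal.toReal_eq_toReal_iff' (Lp.memLp _).2.ne
    (Lp.memLp _).2.ne, eLpNorm_congr_ae h1, eLpNorm_congr_ae hf2.coeFn_toLp] at h3
  exact h3

lemma eLpNorm_two_comp_mul_left {f : ℝ → ℂ} (hf : AEStronglyMeasurable f volume) {c : ℝ}
    (hc : c ≠ 0) : eLpNorm (fun x => f (c * x)) 2 volume =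
      ENNReal.ofReal |c⁻¹| ^ (1 / 2 : ℝ) * eLpNorm f 2 volume := by
  have hmap := Real.map_volume_mul_left hc
  have h0 : ENNReal.ofReal |c⁻¹| ≠ 0 := by
    rw [Ne, ENNReal.ofReal_eq_zero, not_le]; positivity
  have h1 : eLpNorm f 2 (Measure.map (fun x => c * x) volume) =
      eLpNorm (fun x => f (c * x)) 2 volume := by
    refine eLpNorm_map_measure ?_ (by fun_prop)
    rw [hmap]
    exact hf.smul_measure _
  rw [← h1, hmap, eLpNorm_smul_measure_of_ne_zero h0]
  simp

lemma integral_exp_mul_eq_fourier (f : ℝ → ℂ) (x : ℝ) :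
    ∫ ξ : ℝ, Complex.exp (-Complex.I * (ξ : ℂ) * (x : ℂ)) * f ξ =
      𝓕 f ((2 * Real.pi)⁻¹ * x) := by
  rw [Real.fourier_real_eq_integral_exp_smul]
  refine integral_congr_ae (Eventually.of_forall fun ξ => ?_)
  simp only [smul_eq_mul]
  congr 2
  have : (Real.pi : ℂ) ≠ 0 := by exact_mod_cast Real.pi_ne_zero
  push_cast
  field_simp

/-- Plancherel's identity, up to a constant, for `x ↦ ∫ e^{-iξx} f(ξ) dξ`. -/
theorem memLp_integral_exp_and_eLpNorm_eq {f : ℝ → ℂ} (hf : Integrable f) (hf2 : MemLp f 2) :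
    MemLp (fun x : ℝ => ∫ ξ : ℝ, Complex.exp (-Complex.I * (ξ : ℂ) * (x : ℂ)) * f ξ) 2 ∧
    eLpNorm (fun x : ℝ => ∫ ξ : ℝ, Complex.exp (-Complex.I * (ξ : ℂ) * (x : ℂ)) * f ξ) 2 volume =
      ENNReal.ofReal |(2 * Real.pi)| ^ (1 / 2 : ℝ) * eLpNorm f 2 volume := by
  obtain ⟨h1, h2⟩ := memLp_fourier_and_eLpNorm_fourier_eq hf hf2
  have hc : (2 * Real.pi)⁻¹ ≠ 0 := by positivity
  have hcont := continuous_fourier_of_integrable hf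
  have h3 := eLpNorm_two_comp_mul_left hcont.aestronglyMeasurable hc
  rw [h2, inv_inv] at h3
  simp only [integral_exp_mul_eq_fourier]
  refine ⟨⟨(hcont.comp (continuous_const.mul continuous_id)).aestronglyMeasurable, ?_⟩, h3⟩
  rw [h3]
  exact ENNReal.mul_lt_top (ENNReal.rpow_lt_top_of_nonneg (by norm_num) ENNReal.ofReal_ne_top)
    hf2.2

end Plancherel

/-! ### The controls `t₊² e^{-εt}` and their Laplace transforms -/

/-- The function `t₊² e^{-εt}`. -/
noncomputable def quadControl (ε t : ℝ) : ℂ := ((max t 0 ^ 2 * Real.exp (-ε * t) : ℝ) : ℂ)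

@[fun_prop] lemma continuous_quadControl (ε : ℝ) : Continuous (quadControl ε) := by
  unfold quadControl; fun_prop

lemma quadControl_of_nonpos (ε : ℝ) {t : ℝ} (ht : t ≤ 0) : quadControl ε t = 0 := by
  simp [quadControl, max_eq_right ht]

lemma quadControl_of_nonneg (ε : ℝ) {t : ℝ} (ht : 0 ≤ t) :
    quadControl ε t = (t : ℂ) ^ 2 * Real.exp (-ε * t) := by
  simp [quadControl, max_eq_left ht]

lemma integrableOn_pow_mul_cexp (k : ℕ) {w : ℂ} (hw : 0 < w.re) :
    IntegrableOn (fun t : ℝ => (t : ℂ) ^ k * Complex.exp (-w * t)) (Ioi 0) := by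
  have h := integrableOn_rpow_mul_exp_neg_mul_rpow (p := 1) (s := k) (b := w.re)
    (by have : (0 : ℝ) ≤ k := k.cast_nonneg
        linarith) one_pos hw
  refine Integrable.mono' h (by fun_prop) ?_
  filter_upwards [ae_restrict_mem measurableSet_Ioi] with t ht
  rw [norm_mul, norm_pow, Complex.norm_real, Real.norm_of_nonneg (le_of_lt ht),
    Complex.norm_exp]
  simp

lemma integral_sq_mul_cexp {w : ℂ} (hw : 0 < w.re) :
    ∫ t : ℝ in Ioi 0, (t : ℂ) ^ 2 * Complex.exp (-w * t) = 2 / w ^ 3 := by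
  have hw0 : w ≠ 0 := by rintro rfl; simp at hw
  have h0 := integrableOn_pow_mul_cexp 0 hw
  have h1 := integrableOn_pow_mul_cexp 1 hw
  have h2 := integrableOn_pow_mul_cexp 2 hw
  have hd : ∀ x : ℝ, 0 ≤ x → HasDerivWithinAt
      (fun t : ℝ => -((t : ℂ) ^ 2 / w + 2 * t / w ^ 2 + 2 / w ^ 3) * Complex.exp (-w * t))
      ((x : ℂ) ^ 2 * Complex.exp (-w * x)) (Ici 0) x := by
    intro x _
    have hx : HasDerivAt (fun t : ℝ => (t : ℂ)) 1 x := Complex.ofRealCLM.hasDerivAt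
    have hp := ((((hx.pow 2).div_const w).add ((hx.const_mul 2).div_const (w ^ 2))).add_const
      (2 / w ^ 3)).neg
    have he := (hx.const_mul (-w)).cexp
    refine (hp.mul he).hasDerivWithinAt.congr_deriv ?_
    simp
    field_simp
    ring
  have hint : IntegrableOn (fun t : ℝ =>
      -((t : ℂ) ^ 2 / w + 2 * t / w ^ 2 + 2 / w ^ 3) * Complex.exp (-w * t)) (Ioi 0) := by
    refine (((h2.const_mul (1 / w)).add (h1.const_mul (2 / w ^ 2))).add
      (h0.const_mul (2 / w ^ 3))).neg.congr (Eventually.of_forall fun t => ?_)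
    simp
    ring
  rw [integral_Ioi_deriv_eq_neg hd hint h2]
  simp

lemma integrable_quadControl {c : ℝ} (hc : 0 < c) : Integrable (quadControl c) := by
  rw [← integrableOn_univ, ← Iic_union_Ioi (a := (0 : ℝ)), integrableOn_union]
  constructor
  · refine (integrableOn_zero (s := Iic (0 : ℝ))).congr_fun (fun t ht => ?_) measurableSet_Iic
    rw [quadControl_of_nonpos c ht]
  · refine (integrableOn_pow_mul_cexp 2 (w := c) (by simpa)).congr_fun (fun t ht => ?_)
      measurableSet_Ioi
    rw [quadControl_of_nonneg c (le_of_lt ht)]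
    push_cast; rfl

/-- The Laplace transform of `t₊² e^{-εt}`, as a function of `z = ξ + i η`. -/
noncomputable def quadControlHat (ε : ℝ) (z : ℂ) : ℂ := 2 / (ε - Complex.I * z) ^ 3

section

open scoped FourierTransform

lemma fourierInv_quadControl {c : ℝ} (hc : 0 < c) (w : ℝ) :
    𝓕⁻ (quadControl c) w = 2 / (-Complex.I * hline c (2 * Real.pi * w)) ^ 3 := by
  rw [Real.fourierInv_eq']
  have h1 : ∀ v : ℝ, Complex.exp (((2 * Real.pi * inner ℝ v w : ℝ) : ℂ) * Complex.I) •
      quadControl c v = (Ioi (0 : ℝ)).indicator (fun t : ℝ => (t : ℂ) ^ 2 *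
        Complex.exp (-(-Complex.I * hline c (2 * Real.pi * w)) * t)) v := by
    intro v
    by_cases hv : v ∈ Ioi (0 : ℝ)
    · rw [indicator_of_mem hv, quadControl_of_nonneg c (le_of_lt hv), smul_eq_mul,
        Complex.ofReal_exp, mul_left_comm, ← Complex.exp_add]
      congr 2
      simp [hline]
      ring_nf
      simp only [Complex.I_sq]
      ring
    · rw [indicator_of_notMem hv, quadControl_of_nonpos c (not_lt.1 hv), smul_zero]
  simp only [h1]
  rw [integral_indicator measurableSet_Ioi, integral_sq_mul_cexp]
  simpa [hline] using hc

lemma hline_ne_zero {η : ℝ} (hη : 0 < η) (ξ : ℝ) : hline η ξ ≠ 0 :=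
  norm_pos_iff.1 (norm_hline_pos hη ξ)

lemma integrable_two_div_hline_pow {c : ℝ} (hc : 0 < c) :
    Integrable fun ξ => 2 / (-Complex.I * hline c ξ) ^ 3 := by
  have hne : ∀ ξ, -Complex.I * hline c ξ ≠ 0 := fun ξ =>
    mul_ne_zero (neg_ne_zero.2 Complex.I_ne_zero) (hline_ne_zero hc ξ)
  refine Integrable.mono' ((integrable_inv_norm_hline_sq hc).const_mul (2 / c))
    (Continuous.aestronglyMeasurable ?_) (Eventually.of_forall fun ξ => ?_)
  · exact continuous_const.div (by fun_prop) fun ξ => pow_ne_zero 3 (hne ξ)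
  · rw [norm_div, norm_pow, norm_mul, norm_neg, Complex.norm_I, one_mul, Complex.norm_two]
    have h0 := norm_hline_pos hc ξ
    have h1 := le_norm_hline (η := c) ξ
    rw [← div_eq_mul_inv, div_div, div_le_div_iff_of_pos_left two_pos (by positivity)
      (by positivity)]
    nlinarith [sq_nonneg ‖hline c ξ‖]

/-- Fourier inversion applies because `quadControl` is continuous and integrable with integrable
transform; the substitution `ξ = 2πv` accounts for the factor `2π`. -/
lemma integral_exp_two_div_hline {c : ℝ} (hc : 0 < c) (t : ℝ) :
    ∫ ξ : ℝ, Complex.exp (-Complex.I * ξ * t) * (2 / (-Complex.I * hline c ξ) ^ 3) =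
      2 * Real.pi * quadControl c t := by
  have hpi : (2 * Real.pi) ≠ 0 := by positivity
  have hint := integrable_two_div_hline_pow hc
  have hF : Integrable (𝓕 (quadControl c)) := by
    have : 𝓕 (quadControl c) = fun w => 2 / (-Complex.I * hline c (-(2 * Real.pi) * w)) ^ 3 := by
      ext w
      have h := Real.fourierInv_eq_fourier_neg (quadControl c) (-w)
      rw [neg_neg, fourierInv_quadControl hc] at h
      rw [← h]
      congr 4
      ring
    rw [this]
    exact hint.comp_mul_left' (neg_ne_zero.2 hpi)
  have hinv := congrFun ((continuous_quadControl c).fourier_fourierInv_eq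
    (integrable_quadControl hc) hF) t
  rw [Real.fourier_real_eq_integral_exp_smul] at hinv
  simp only [fourierInv_quadControl hc, smul_eq_mul] at hinv
  have h := Measure.integral_comp_mul_left (fun ξ : ℝ =>
    Complex.exp (-Complex.I * ξ * t) * (2 / (-Complex.I * hline c ξ) ^ 3)) (2 * Real.pi)
  have h' : ∫ v : ℝ, Complex.exp (((-2 * Real.pi * v * t : ℝ) : ℂ) * Complex.I) *
      (2 / (-Complex.I * hline c (2 * Real.pi * v)) ^ 3) =
      ∫ v : ℝ, Complex.exp (-Complex.I * ((2 * Real.pi * v : ℝ) : ℂ) * t) *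
      (2 / (-Complex.I * hline c (2 * Real.pi * v)) ^ 3) := by
    refine integral_congr_ae (Eventually.of_forall fun v => ?_)
    simp only
    congr 2
    push_cast
    ring
  rw [h', h] at hinv
  rw [← hinv, abs_of_pos (by positivity), Complex.real_smul, ← mul_assoc, ← Complex.ofReal_ofNat,
    ← Complex.ofReal_mul, ← Complex.ofReal_mul, mul_inv_cancel₀ hpi, Complex.ofReal_one, one_mul]

end

lemma exp_hline (η ξ t : ℝ) : Complex.exp (-Complex.I * hline η ξ * t) =
    Real.exp (η * t) * Complex.exp (-Complex.I * ξ * t) := by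
  rw [Complex.ofReal_exp, ← Complex.exp_add]
  congr 1
  simp [hline]
  ring_nf
  simp only [Complex.I_sq]
  ring

lemma norm_exp_mul (z : ℂ) (t : ℝ) :
    ‖Complex.exp (-Complex.I * z * t)‖ = Real.exp (z.im * t) := by
  rw [Complex.norm_exp]; simp

/-- Laplace inversion for the control `t₊² e^{-εt}`. -/
lemma integral_exp_mul_quadControlHat {ε η : ℝ} (hε : 0 ≤ ε) (hη : 0 < η) (t : ℝ) :
    ∫ ξ, Complex.exp (-Complex.I * hline η ξ * t) * quadControlHat ε (hline η ξ) =
      2 * Real.pi * quadControl ε t := by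
  -- Since `ε - i(ξ + iη) = -i(ξ + i(ε + η))`, damping the control amounts to raising the line from
  -- `η` to `ε + η`. This also covers `ε = 0`.
  have h := integral_exp_two_div_hline (add_pos_of_nonneg_of_pos hε hη) t
  have e : ∀ ξ, Complex.exp (-Complex.I * hline η ξ * t) * quadControlHat ε (hline η ξ) =
      Real.exp (η * t) * (Complex.exp (-Complex.I * ξ * t) *
        (2 / (-Complex.I * hline (ε + η) ξ) ^ 3)) := by
    intro ξ
    rw [exp_hline, quadControlHat, mul_assoc]
    congr 4
    simp [hline]
    ring_nf
    simp only [Complex.I_sq]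
    ring
  simp only [e]
  rw [integral_const_mul, h, mul_left_comm]
  congr 1
  rw [quadControl, quadControl, ← Complex.ofReal_mul]
  congr 1
  rw [mul_left_comm, ← Real.exp_add]
  ring_nf

lemma sub_I_mul_ne_zero {ε : ℝ} (hε : 0 ≤ ε) {z : ℂ} (hz : 0 < z.im) :
    (ε : ℂ) - Complex.I * z ≠ 0 := by
  intro h
  have := congrArg Complex.re h
  simp at this
  linarith

lemma differentiableOn_quadControlHat {ε : ℝ} (hε : 0 ≤ ε) :
    DifferentiableOn ℂ (quadControlHat ε) upperPlane := by
  unfold quadControlHat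
  refine DifferentiableOn.div (by fun_prop) (by fun_prop) fun z hz => ?_
  exact pow_ne_zero 3 (sub_I_mul_ne_zero hε hz)

lemma norm_le_norm_sub_I_mul {ε : ℝ} (hε : 0 ≤ ε) {z : ℂ} (hz : 0 < z.im) :
    ‖z‖ ≤ ‖(ε : ℂ) - Complex.I * z‖ := by
  refine le_of_sq_le_sq ?_ (norm_nonneg _)
  rw [Complex.sq_norm, Complex.sq_norm, Complex.normSq_apply, Complex.normSq_apply]
  simp
  nlinarith [mul_nonneg hε hz.le]

lemma norm_quadControlHat_le {ε : ℝ} (hε : 0 ≤ ε) {z : ℂ} (hz : 0 < z.im) :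
    ‖quadControlHat ε z‖ ≤ 2 / ‖z‖ ^ 3 := by
  have hz0 : 0 < ‖z‖ := norm_pos_iff.2 (by rintro rfl; simp at hz)
  rw [quadControlHat, norm_div, norm_pow, Complex.norm_two]
  gcongr
  exact norm_le_norm_sub_I_mul hε hz

lemma hasDerivAt_max_zero_sq (t : ℝ) :
    HasDerivAt (fun t : ℝ => max t 0 ^ 2) (2 * max t 0) t := by
  rcases lt_trichotomy t 0 with ht | rfl | ht
  · rw [max_eq_right ht.le, mul_zero]
    refine (hasDerivAt_const t (0 : ℝ)).congr_of_eventuallyEq ?_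
    filter_upwards [Iio_mem_nhds ht] with s hs
    rw [max_eq_right (le_of_lt hs)]; simp
  · rw [max_self, mul_zero, hasDerivAt_iff_isLittleO]
    refine Asymptotics.IsBigO.trans_isLittleO ?_
      (Asymptotics.isLittleO_pow_sub_sub (0 : ℝ) one_lt_two)
    refine Asymptotics.IsBigO.of_bound 1 (Eventually.of_forall fun s => ?_)
    simp only [max_self, smul_zero, sub_zero, one_mul, norm_pow, norm_norm]
    rw [zero_pow two_ne_zero, sub_zero, norm_pow]
    gcongr
    rw [Real.norm_of_nonneg (le_max_right _ _)]
    exact max_le (le_abs_self s) (abs_nonneg s)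
  · rw [max_eq_left ht.le]
    refine HasDerivAt.congr_of_eventuallyEq (f := fun t => t ^ 2) ?_ ?_
    · simpa using hasDerivAt_pow 2 t
    · filter_upwards [Ioi_mem_nhds ht] with s hs
      rw [max_eq_left (le_of_lt hs)]

lemma hasDerivAt_quadControl (ε t : ℝ) :
    HasDerivAt (quadControl ε)
      (((2 * max t 0 - ε * max t 0 ^ 2) * Real.exp (-ε * t) : ℝ) : ℂ) t := by
  have h1 : HasDerivAt (fun t => Real.exp (-ε * t)) (Real.exp (-ε * t) * -ε) t := by
    simpa using ((hasDerivAt_id t).const_mul (-ε)).exp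
  refine (((hasDerivAt_max_zero_sq t).mul h1).ofReal_comp).congr_deriv ?_
  push_cast
  ring

/-- The square makes the control `C¹` at `0`, and the damping `ε > 0` makes it bounded together with
its derivative. -/
lemma isAdmissibleControl_quadControl {ε : ℝ} (hε : 0 < ε) :
    IsAdmissibleControl (quadControl ε) := by
  have hderiv : deriv (quadControl ε) = fun t =>
      (((2 * max t 0 - ε * max t 0 ^ 2) * Real.exp (-ε * t) : ℝ) : ℂ) :=
    funext fun t => (hasDerivAt_quadControl ε t).deriv
  have hb : ∀ t : ℝ, ε * (max t 0 * Real.exp (-ε * t)) ≤ 1 ∧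
      ε ^ 2 * (max t 0 ^ 2 * Real.exp (-ε * t)) ≤ 2 := by
    intro t
    rcases le_total t 0 with ht | ht
    · simp [max_eq_right ht]
    · rw [max_eq_left ht]
      have h := Real.quadratic_le_exp_of_nonneg (mul_nonneg hε.le ht)
      have h0 : 0 ≤ ε * t := mul_nonneg hε.le ht
      have h1 : Real.exp (ε * t) * Real.exp (-ε * t) = 1 := by
        rw [← Real.exp_add, Real.exp_eq_one_iff]; ring
      have h2 := Real.exp_pos (-ε * t)
      constructor
      · nlinarith [sq_nonneg (ε * t)]
      · nlinarith [sq_nonneg (ε * t)]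
  refine ⟨contDiff_one_iff_deriv.2 ⟨fun t => (hasDerivAt_quadControl ε t).differentiableAt, ?_⟩,
    fun t ht => quadControl_of_nonpos ε ht, fun t ht => ?_, ⟨2 / ε ^ 2, fun t => ?_⟩,
    ⟨2 / ε + 2 / ε, fun t => ?_⟩⟩
  · rw [hderiv]; fun_prop
  · rw [hderiv]; simp [max_eq_right ht]
  · rw [quadControl, Complex.norm_real, Real.norm_of_nonneg (by positivity),
      le_div_iff₀ (by positivity), mul_comm]
    exact (hb t).2
  · simp only [hderiv]
    rw [Complex.norm_real]
    have h1 : 0 ≤ max t 0 * Real.exp (-ε * t) :=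
      mul_nonneg (le_max_right _ _) (Real.exp_pos _).le
    have h2 : 0 ≤ max t 0 ^ 2 * Real.exp (-ε * t) := by positivity
    have e1 : max t 0 * Real.exp (-ε * t) ≤ 1 / ε := by
      rw [le_div_iff₀ hε, mul_comm]; exact (hb t).1
    have e2 : ε * (max t 0 ^ 2 * Real.exp (-ε * t)) ≤ 2 / ε := by
      rw [le_div_iff₀ hε]; nlinarith [(hb t).2]
    have e3 : 0 ≤ ε * (max t 0 ^ 2 * Real.exp (-ε * t)) := mul_nonneg hε.le h2
    have e4 : 2 * (1 / ε) = 2 / ε := by ring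
    have e5 : 0 ≤ 2 / ε := by positivity
    rw [Real.norm_eq_abs, abs_le]
    constructor <;> nlinarith

/-! ### Laplace inversion of Weyl solutions -/

/-- The bounds and regularity of a component of a normalized Weyl solution. -/
structure IsLaplaceKernel (M : ℝ) (G : ℂ → ℝ → ℂ) : Prop where
  continuousOn : ∀ z : ℂ, 0 < z.im → ContinuousOn (G z) (Ici 0)
  differentiableOn : ∀ x, 0 ≤ x → DifferentiableOn ℂ (fun z => G z x) upperPlane
  bound : ∀ η : ℝ, 0 < η → ∃ B, 0 ≤ B ∧ ∀ z : ℂ, η ≤ z.im → ∀ x, 0 ≤ x →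
    ‖G z x‖ ≤ B * Real.exp ((M - z.im) * x)

lemma IsNormalizedWeylFamily.isLaplaceKernel_fst {p q : ℝ → ℝ} {φ : ℂ → ℂ} {M : ℝ}
    {Φ₁ Φ₂ : ℂ → ℝ → ℂ} (h : IsNormalizedWeylFamily p q φ M Φ₁ Φ₂) : IsLaplaceKernel M Φ₁ where
  continuousOn z hz := continuousOn_of_hasDerivWithinAt (h.deriv_fst z hz)
  differentiableOn := h.differentiableOn_fst
  bound η hη := by
    obtain ⟨B, hB0, hB⟩ := h.bound η hη
    exact ⟨B, hB0, fun z hz x hx => (hB z hz x hx).1⟩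

lemma IsNormalizedWeylFamily.isLaplaceKernel_snd {p q : ℝ → ℝ} {φ : ℂ → ℂ} {M : ℝ}
    {Φ₁ Φ₂ : ℂ → ℝ → ℂ} (h : IsNormalizedWeylFamily p q φ M Φ₁ Φ₂) : IsLaplaceKernel M Φ₂ where
  continuousOn z hz := continuousOn_of_hasDerivWithinAt (h.deriv_snd z hz)
  differentiableOn := h.differentiableOn_snd
  bound η hη := by
    obtain ⟨B, hB0, hB⟩ := h.bound η hη
    exact ⟨B, hB0, fun z hz x hx => (hB z hz x hx).2⟩

/-- The inverse Laplace transform of `k(z) G(z, x)` along the line at height `η`. -/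
noncomputable def laplaceInv (k : ℂ → ℂ) (G : ℂ → ℝ → ℂ) (η x t : ℝ) : ℂ :=
  (2 * Real.pi : ℂ)⁻¹ *
    ∫ ξ, Complex.exp (-Complex.I * hline η ξ * t) * (k (hline η ξ) * G (hline η ξ) x)

lemma laplaceInv_eq_exp_mul (k : ℂ → ℂ) (G : ℂ → ℝ → ℂ) (η x t : ℝ) :
    laplaceInv k G η x t = (2 * Real.pi : ℂ)⁻¹ * (Real.exp (η * t) *
      ∫ ξ : ℝ, Complex.exp (-Complex.I * ξ * t) * (k (hline η ξ) * G (hline η ξ) x)) := by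
  rw [laplaceInv, ← integral_const_mul (Real.exp (η * t) : ℂ)]
  simp only [exp_hline, mul_assoc (Real.exp (η * t) : ℂ)]

namespace IsLaplaceKernel

variable {M : ℝ} {G : ℂ → ℝ → ℂ} {k : ℂ → ℂ} {η A : ℝ}

lemma differentiableOn_integrand (hG : IsLaplaceKernel M G)
    (hk : DifferentiableOn ℂ k upperPlane) {x : ℝ} (hx : 0 ≤ x) (t : ℝ) :
    DifferentiableOn ℂ (fun z => Complex.exp (-Complex.I * z * t) * (k z * G z x)) upperPlane :=
  DifferentiableOn.mul (by fun_prop) (hk.mul (hG.differentiableOn x hx))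

lemma exists_norm_integrand_le (hG : IsLaplaceKernel M G) (hη : 0 < η) (hM : M ≤ η)
    (hkA : ∀ z : ℂ, z.im = η → ‖k z‖ ≤ A * (‖z‖ ^ 2)⁻¹) :
    ∃ B, 0 ≤ B ∧ ∀ ξ x, 0 ≤ x → ‖k (hline η ξ) * G (hline η ξ) x‖ ≤
      B * (‖hline η ξ‖ ^ 2)⁻¹ := by
  obtain ⟨B, hB0, hB⟩ := hG.bound η hη
  have hA : 0 ≤ A := by
    have h := (norm_nonneg _).trans (hkA (hline η 0) (by simp))
    exact nonneg_of_mul_nonneg_left h (by have := norm_hline_pos hη 0; positivity)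
  refine ⟨A * B, by positivity, fun ξ x hx => ?_⟩
  have h1 := hB (hline η ξ) (by simp) x hx
  have h2 : Real.exp ((M - (hline η ξ).im) * x) ≤ 1 := by
    rw [Real.exp_le_one_iff, hline_im]
    exact mul_nonpos_of_nonpos_of_nonneg (by linarith) hx
  rw [norm_mul]
  calc _ ≤ (A * (‖hline η ξ‖ ^ 2)⁻¹) * (B * 1) := by
        gcongr
        · exact hkA _ (by simp)
        · exact h1.trans (by gcongr)
    _ = _ := by ring

lemma integrable_integrand (hG : IsLaplaceKernel M G) (hη : 0 < η) (hM : M ≤ η)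
    (hk : DifferentiableOn ℂ k upperPlane)
    (hkA : ∀ z : ℂ, z.im = η → ‖k z‖ ≤ A * (‖z‖ ^ 2)⁻¹) {x : ℝ} (hx : 0 ≤ x) (t : ℝ) :
    Integrable fun ξ =>
      Complex.exp (-Complex.I * hline η ξ * t) * (k (hline η ξ) * G (hline η ξ) x) := by
  obtain ⟨B, _, hB⟩ := hG.exists_norm_integrand_le hη hM hkA
  refine Integrable.mono' ((integrable_inv_norm_hline_sq hη).const_mul (Real.exp (η * t) * B))
    (continuous_comp_hline (hG.differentiableOn_integrand hk hx t) hη).aestronglyMeasurable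
    (Eventually.of_forall fun ξ => ?_)
  rw [norm_mul, norm_exp_mul, hline_im, mul_assoc]
  gcongr
  exact hB ξ x hx

lemma continuousOn_laplaceInv (hG : IsLaplaceKernel M G) (hη : 0 < η) (hM : M ≤ η)
    (hk : DifferentiableOn ℂ k upperPlane)
    (hkA : ∀ z : ℂ, z.im = η → ‖k z‖ ≤ A * (‖z‖ ^ 2)⁻¹) :
    ContinuousOn (fun w : ℝ × ℝ => laplaceInv k G η w.1 w.2) quarterPlane := by
  obtain ⟨B, _, hB⟩ := hG.exists_norm_integrand_le hη hM hkA
  have hc : ContinuousOn (fun w : ℝ × ℝ => ∫ ξ : ℝ, Complex.exp (-Complex.I * ξ * w.2) *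
      (k (hline η ξ) * G (hline η ξ) w.1)) quarterPlane := by
    refine continuousOn_of_dominated (bound := fun ξ => B * (‖hline η ξ‖ ^ 2)⁻¹) ?_ ?_
      ((integrable_inv_norm_hline_sq hη).const_mul B) ?_
    · intro w hw
      refine Continuous.aestronglyMeasurable (Continuous.mul (by fun_prop) ?_)
      exact continuous_comp_hline (hk.mul (hG.differentiableOn w.1 hw.1)) hη
    · intro w hw
      refine Eventually.of_forall fun ξ => ?_
      rw [norm_mul, Complex.norm_exp]
      simpa using hB ξ w.1 hw.1
    · refine Eventually.of_forall fun ξ => ContinuousOn.mul (by fun_prop) ?_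
      refine ContinuousOn.mul continuousOn_const ?_
      exact (hG.continuousOn _ (by simpa using hη)).comp continuousOn_fst fun w hw => hw.1
  have he : (fun w : ℝ × ℝ => laplaceInv k G η w.1 w.2) = fun w : ℝ × ℝ =>
      (2 * Real.pi : ℂ)⁻¹ * (Real.exp (η * w.2) * ∫ ξ : ℝ, Complex.exp (-Complex.I * ξ * w.2) *
      (k (hline η ξ) * G (hline η ξ) w.1)) := by
    exact funext fun w => laplaceInv_eq_exp_mul k G η w.1 w.2
  rw [he]
  exact continuousOn_const.mul (ContinuousOn.mul (by fun_prop) hc)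

/-- Differentiation in `t` multiplies the symbol by `-iz`. A cubically decaying `k` still leaves
quadratic decay, hence an integrable majorant. -/
lemma hasDerivWithinAt_laplaceInv_time (hG : IsLaplaceKernel M G) (hη : 0 < η) (hM : M ≤ η)
    {A' : ℝ} (hk : DifferentiableOn ℂ k upperPlane)
    (hkA : ∀ z : ℂ, z.im = η → ‖k z‖ ≤ A * (‖z‖ ^ 2)⁻¹)
    (hkA' : ∀ z : ℂ, z.im = η → ‖-Complex.I * z * k z‖ ≤ A' * (‖z‖ ^ 2)⁻¹)
    {x t : ℝ} (hx : 0 ≤ x) (ht : 0 ≤ t) :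
    HasDerivWithinAt (fun t => laplaceInv k G η x t)
      (laplaceInv (fun z => -Complex.I * z * k z) G η x t) (Ici 0) t := by
  obtain ⟨B, hB0, hB⟩ := hG.exists_norm_integrand_le hη hM hkA'
  refine HasDerivWithinAt.const_mul _ ?_
  refine hasDerivWithinAt_integral_Ici
    (F := fun t ξ => Complex.exp (-Complex.I * hline η ξ * t) *
      (k (hline η ξ) * G (hline η ξ) x))
    (F' := fun t ξ => Complex.exp (-Complex.I * hline η ξ * t) *
      (-Complex.I * hline η ξ * k (hline η ξ) * G (hline η ξ) x))
    (bound := fun ξ => Real.exp (η * (t + 1)) * B * (‖hline η ξ‖ ^ 2)⁻¹) ht (lt_add_one t)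
    (fun s _ => hG.integrable_integrand hη hM hk hkA hx s) ?_ ?_
    ((integrable_inv_norm_hline_sq hη).const_mul _)
  · intro ξ s _
    have h1 : HasDerivAt (fun s : ℝ => -Complex.I * hline η ξ * (s : ℂ))
        (-Complex.I * hline η ξ) s := by
      simpa using (Complex.ofRealCLM.hasDerivAt (x := s)).const_mul (-Complex.I * hline η ξ)
    refine (h1.cexp.mul_const _).hasDerivWithinAt.congr_deriv ?_
    ring
  · intro ξ s _ hs
    rw [norm_mul, norm_exp_mul, hline_im, mul_assoc (Real.exp _) B]
    gcongr
    exact hB ξ x hx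

/-- Causality: the inverse Laplace transform vanishes for `t ≤ x`. -/
lemma laplaceInv_eq_zero (hG : IsLaplaceKernel M G) (hη : 0 < η)
    (hk : DifferentiableOn ℂ k upperPlane)
    (hkA : ∀ z : ℂ, 0 < z.im → ‖k z‖ ≤ A / ‖z‖ ^ 3) {x t : ℝ} (hx : 0 ≤ x) (htx : t ≤ x) :
    laplaceInv k G η x t = 0 := by
  obtain ⟨B, hB0, hB⟩ := hG.bound η hη
  have hA : 0 ≤ A := by
    have h := (norm_nonneg _).trans (hkA (hline η 0) (by simpa))
    have h3 : 0 < ‖hline η 0‖ ^ 3 := by have := norm_hline_pos hη 0; positivity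
    rwa [le_div_iff₀ h3, zero_mul] at h
  set D : ℝ := A * B * Real.exp (M * x) with hD
  have hD0 : 0 ≤ D := by positivity
  have hbound : ∀ z : ℂ, η ≤ z.im →
      ‖Complex.exp (-Complex.I * z * t) * (k z * G z x)‖ ≤ D / z.im * (‖z‖ ^ 2)⁻¹ := by
    intro z hz
    have hz0 : 0 < z.im := hη.trans_le hz
    have hzn : z.im ≤ ‖z‖ := (le_abs_self _).trans (Complex.abs_im_le_norm z)
    have hzp : 0 < ‖z‖ := hz0.trans_le hzn
    -- For `t ≤ x` the growth `e^{t Im z}` is compensated by the spatial decay `e^{-x Im z}`.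
    have e1 : Real.exp (z.im * t) * Real.exp ((M - z.im) * x) ≤ Real.exp (M * x) := by
      rw [← Real.exp_add, Real.exp_le_exp]
      nlinarith [mul_nonneg hz0.le (sub_nonneg.2 htx)]
    have e2 : A / ‖z‖ ^ 3 ≤ A / z.im * (‖z‖ ^ 2)⁻¹ := by
      rw [← div_eq_mul_inv, div_div]
      gcongr
      calc z.im * ‖z‖ ^ 2 ≤ ‖z‖ * ‖z‖ ^ 2 := by gcongr
        _ = _ := by ring
    rw [norm_mul, norm_mul, norm_exp_mul]
    calc _ ≤ Real.exp (z.im * t) * ((A / z.im * (‖z‖ ^ 2)⁻¹) *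
          (B * Real.exp ((M - z.im) * x))) := by
          gcongr
          · exact (hkA z hz0).trans e2
          · exact hB z hz x hx
      _ = A / z.im * (‖z‖ ^ 2)⁻¹ * B * (Real.exp (z.im * t) * Real.exp ((M - z.im) * x)) := by
          ring
      _ ≤ A / z.im * (‖z‖ ^ 2)⁻¹ * B * Real.exp (M * x) := by gcongr
      _ = _ := by rw [hD]; ring
  have hzero : ∫ ξ, Complex.exp (-Complex.I * hline η ξ * t) *
      (k (hline η ξ) * G (hline η ξ) x) = 0 := by
    have hdF := hG.differentiableOn_integrand hk hx t
    have hle : ∀ H : ℝ, max η 1 ≤ H → ‖∫ ξ, Complex.exp (-Complex.I * hline η ξ * t) *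
        (k (hline η ξ) * G (hline η ξ) x)‖ ≤ D * Real.pi / H := by
      -- Raise the line to height `H`. Two powers of the decay of `k` are integrable, uniformly for
      -- `H ≥ 1`; the third supplies the factor `1/H`.
      intro H hH
      have hηH : η ≤ H := (le_max_left _ _).trans hH
      have hH1 : 1 ≤ H := (le_max_right _ _).trans hH
      rw [integral_hline_eq (B := D / η) hdF hη hηH fun z hz _ =>
        (hbound z hz).trans (by gcongr)]
      refine (norm_integral_le_of_norm_le ((integrable_inv_norm_hline_sq
        (by linarith : 0 < H)).const_mul (D / H)) (Eventually.of_forall fun ξ => ?_)).trans ?_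
      · have := hbound (hline H ξ) (by simpa)
        rwa [hline_im] at this
      · rw [integral_const_mul, show D * Real.pi / H = D / H * Real.pi by ring]
        gcongr
        exact integral_inv_norm_hline_sq_le hH1
    have hlim : Tendsto (fun H : ℝ => D * Real.pi / H) atTop (𝓝 0) :=
      tendsto_const_nhds.div_atTop tendsto_id
    have := ge_of_tendsto hlim ((eventually_ge_atTop (max η 1)).mono hle)
    exact norm_le_zero_iff.1 this
  rw [laplaceInv, hzero, mul_zero]

/-- On the strip between the lines `e^{t Im z} ≤ e^{η₂ t}` because `t ≥ 0`, so the line can be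
shifted. This later removes the restriction `M ≤ η`. -/
lemma integral_hline_eq_of_time (hG : IsLaplaceKernel M G) (hk : DifferentiableOn ℂ k upperPlane)
    (hkA : ∀ z : ℂ, 0 < z.im → ‖k z‖ ≤ A / ‖z‖ ^ 3) {η₁ η₂ : ℝ} (h1 : 0 < η₁) (h12 : η₁ ≤ η₂)
    {t : ℝ} (ht : 0 ≤ t) : laplaceInv k G η₁ 0 t = laplaceInv k G η₂ 0 t := by
  obtain ⟨B, hB0, hB⟩ := hG.bound η₁ h1
  have hA : 0 ≤ A := by
    have h := (norm_nonneg _).trans (hkA (hline η₁ 0) (by simpa))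
    have h3 : 0 < ‖hline η₁ 0‖ ^ 3 := by have := norm_hline_pos h1 0; positivity
    rwa [le_div_iff₀ h3, zero_mul] at h
  rw [laplaceInv, laplaceInv, integral_hline_eq (B := Real.exp (η₂ * t) * (A / η₁ * B))
    (hG.differentiableOn_integrand hk le_rfl t) h1 h12]
  intro z hz hz2
  have hz0 : 0 < z.im := h1.trans_le hz
  have hzn : η₁ ≤ ‖z‖ := hz.trans ((le_abs_self _).trans (Complex.abs_im_le_norm z))
  have hzp : 0 < ‖z‖ := h1.trans_le hzn
  have e2 : A / ‖z‖ ^ 3 ≤ A / η₁ * (‖z‖ ^ 2)⁻¹ := by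
    rw [← div_eq_mul_inv, div_div]
    gcongr
    calc η₁ * ‖z‖ ^ 2 ≤ ‖z‖ * ‖z‖ ^ 2 := by gcongr
      _ = _ := by ring
  have e3 := hB z hz 0 le_rfl
  rw [mul_zero, Real.exp_zero, mul_one] at e3
  rw [norm_mul, norm_mul, norm_exp_mul]
  calc _ ≤ Real.exp (η₂ * t) * ((A / η₁ * (‖z‖ ^ 2)⁻¹) * B) := by
        gcongr
        exact (hkA z hz0).trans e2
    _ = _ := by ring

end IsLaplaceKernel

/-- The factor `z` in the spectral equation becomes `i` times the time-derivative symbol `-iz`; in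
this way the differential equation in `x` turns into the dynamical system. The coefficients `σ, α,
β` serve both components at once. -/
lemma IsLaplaceKernel.hasDerivWithinAt_laplaceInv_space {M η A A' C : ℝ} {G H : ℂ → ℝ → ℂ}
    {k : ℂ → ℂ} {α β : ℝ → ℂ} {σ : ℂ} (hG : IsLaplaceKernel M G) (hH : IsLaplaceKernel M H)
    (hη : 0 < η) (hM : M ≤ η) (hk : DifferentiableOn ℂ k upperPlane)
    (hkA : ∀ z : ℂ, z.im = η → ‖k z‖ ≤ A * (‖z‖ ^ 2)⁻¹)
    (hkA' : ∀ z : ℂ, z.im = η → ‖-Complex.I * z * k z‖ ≤ A' * (‖z‖ ^ 2)⁻¹)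
    (hd : ∀ z : ℂ, 0 < z.im → ∀ x, 0 ≤ x →
      HasDerivWithinAt (G z) (α x * G z x + (σ * z + β x) * H z x) (Ici 0) x)
    (hα : ∀ x, 0 ≤ x → ‖α x‖ ≤ C) (hβ : ∀ x, 0 ≤ x → ‖β x‖ ≤ C)
    {x : ℝ} (hx : 0 ≤ x) (t : ℝ) :
    HasDerivWithinAt (fun x => laplaceInv k G η x t)
      (α x * laplaceInv k G η x t +
        σ * Complex.I * laplaceInv (fun z => -Complex.I * z * k z) H η x t +
        β x * laplaceInv k H η x t) (Ici 0) x := by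
  obtain ⟨B₁, hB₁0, hB₁⟩ := hG.exists_norm_integrand_le hη hM hkA
  obtain ⟨B₂, hB₂0, hB₂⟩ := hH.exists_norm_integrand_le hη hM hkA
  obtain ⟨B₃, hB₃0, hB₃⟩ := hH.exists_norm_integrand_le hη hM hkA'
  have hk' : DifferentiableOn ℂ (fun z => -Complex.I * z * k z) upperPlane :=
    DifferentiableOn.mul (by fun_prop) hk
  have i1 := hG.integrable_integrand hη hM hk hkA hx t
  have i2 := hH.integrable_integrand hη hM hk hkA hx t
  have i3 := hH.integrable_integrand hη hM hk' hkA' hx t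
  have hC0 : 0 ≤ C := (norm_nonneg _).trans (hα 0 le_rfl)
  set P : ℝ → ℂ := fun ξ => Complex.exp (-Complex.I * hline η ξ * t) with hP
  set kz : ℝ → ℂ := fun ξ => k (hline η ξ) with hkz
  have key := hasDerivWithinAt_integral_Ici
    (F := fun x ξ => P ξ * (kz ξ * G (hline η ξ) x))
    (F' := fun x ξ => α x * (P ξ * (kz ξ * G (hline η ξ) x)) +
      σ * Complex.I * (P ξ * (-Complex.I * hline η ξ * kz ξ * H (hline η ξ) x)) +
      β x * (P ξ * (kz ξ * H (hline η ξ) x)))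
    (bound := fun ξ => Real.exp (η * t) * (C * B₁ + ‖σ‖ * B₃ + C * B₂) * (‖hline η ξ‖ ^ 2)⁻¹)
    hx (lt_add_one x) (fun y hy => hG.integrable_integrand hη hM hk hkA hy t) ?_ ?_
    ((integrable_inv_norm_hline_sq hη).const_mul _)
  · refine (key.const_mul (2 * Real.pi : ℂ)⁻¹).congr_deriv ?_
    have i13 : Integrable fun ξ => α x * (P ξ * (kz ξ * G (hline η ξ) x)) +
        σ * Complex.I * (P ξ * (-Complex.I * hline η ξ * kz ξ * H (hline η ξ) x)) :=
      (i1.const_mul _).add (i3.const_mul _)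
    rw [integral_add i13 (i2.const_mul _),
      integral_add (i1.const_mul _) (i3.const_mul _), integral_const_mul, integral_const_mul,
      integral_const_mul]
    simp only [laplaceInv]
    ring
  · intro ξ y hy
    refine (((hd (hline η ξ) (by simpa) y hy).const_mul (kz ξ)).const_mul (P ξ)).congr_deriv ?_
    ring_nf
    simp only [Complex.I_sq]
    ring
  · intro ξ y hy _
    have hPn : ‖P ξ‖ = Real.exp (η * t) := by rw [hP]; simp only [norm_exp_mul, hline_im]
    have e1 := hB₁ ξ y hy
    have e2 := hB₂ ξ y hy
    have e3 := hB₃ ξ y hy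
    have a1 := hα y hy
    have a2 := hβ y hy
    refine (norm_add₃_le).trans ?_
    have n1 : ‖α y * (P ξ * (kz ξ * G (hline η ξ) y))‖ ≤
        C * (Real.exp (η * t) * (B₁ * (‖hline η ξ‖ ^ 2)⁻¹)) := by
      rw [norm_mul, norm_mul, hPn]; gcongr
    have n2 : ‖β y * (P ξ * (kz ξ * H (hline η ξ) y))‖ ≤
        C * (Real.exp (η * t) * (B₂ * (‖hline η ξ‖ ^ 2)⁻¹)) := by
      rw [norm_mul, norm_mul, hPn]; gcongr
    have n3 : ‖σ * Complex.I * (P ξ * (-Complex.I * hline η ξ * kz ξ * H (hline η ξ) y))‖ ≤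
        ‖σ‖ * (Real.exp (η * t) * (B₃ * (‖hline η ξ‖ ^ 2)⁻¹)) := by
      rw [norm_mul, norm_mul σ, Complex.norm_I, mul_one, norm_mul (P ξ), hPn]; gcongr
    refine (add_le_add (add_le_add n1 n3) n2).trans (le_of_eq ?_)
    ring

lemma norm_quadControlHat_le_of_im_eq {ε η : ℝ} (hε : 0 ≤ ε) (hη : 0 < η) {z : ℂ}
    (hz : z.im = η) : ‖quadControlHat ε z‖ ≤ 2 / η * (‖z‖ ^ 2)⁻¹ ∧
      ‖-Complex.I * z * quadControlHat ε z‖ ≤ 2 * (‖z‖ ^ 2)⁻¹ := by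
  have hz0 : 0 < z.im := by rwa [hz]
  have hzn : z.im ≤ ‖z‖ := (le_abs_self _).trans (Complex.abs_im_le_norm z)
  have hzp : 0 < ‖z‖ := hz0.trans_le hzn
  have h := norm_quadControlHat_le hε hz0
  constructor
  · refine h.trans ?_
    rw [← div_eq_mul_inv, div_div]
    gcongr
    calc η * ‖z‖ ^ 2 ≤ ‖z‖ * ‖z‖ ^ 2 := by gcongr; rwa [← hz]
      _ = _ := by ring
  · rw [norm_mul, norm_mul, norm_neg, Complex.norm_I, one_mul]
    calc ‖z‖ * ‖quadControlHat ε z‖ ≤ ‖z‖ * (2 / ‖z‖ ^ 3) := by gcongr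
      _ = _ := by field_simp

/-- The classical solution of the dynamical Dirac system with control `t₊² e^{-εt}`, obtained by
Laplace inversion from the Weyl solutions of the spectral system. -/
theorem IsNormalizedWeylFamily.isDynamicalSolution {p q : ℝ → ℝ} {φ : ℂ → ℂ} {M ε η C : ℝ}
    {Φ₁ Φ₂ : ℂ → ℝ → ℂ} (h : IsNormalizedWeylFamily p q φ M Φ₁ Φ₂) (hε : 0 ≤ ε)
    (hp : ContinuousOn p (Ici 0)) (hq : ContinuousOn q (Ici 0))
    (hV : ∀ x, 0 ≤ x → |p x| ≤ C ∧ |q x| ≤ C) (hη : 0 < η) (hM : M ≤ η) :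
    IsDynamicalSolution p q (quadControl ε) (fun x t =>
      ![laplaceInv (quadControlHat ε) Φ₁ η x t, laplaceInv (quadControlHat ε) Φ₂ η x t]) := by
  have h₁ := h.isLaplaceKernel_fst
  have h₂ := h.isLaplaceKernel_snd
  have hk := differentiableOn_quadControlHat hε
  have hkA := fun z hz => (norm_quadControlHat_le_of_im_eq hε hη (z := z) hz).1
  have hkA' := fun z hz => (norm_quadControlHat_le_of_im_eq hε hη (z := z) hz).2
  have hkA3 := fun z hz => norm_quadControlHat_le hε (z := z) hz
  have hk' : DifferentiableOn ℂ (fun z => -Complex.I * z * quadControlHat ε z) upperPlane :=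
    DifferentiableOn.mul (by fun_prop) hk
  set k := quadControlHat ε
  set k' : ℂ → ℂ := fun z => -Complex.I * z * k z
  set u₁ := laplaceInv k Φ₁ η
  set u₂ := laplaceInv k Φ₂ η
  set w₁ := laplaceInv k' Φ₁ η
  set w₂ := laplaceInv k' Φ₂ η
  have cu₁ : ContinuousOn (fun z : ℝ × ℝ => u₁ z.1 z.2) quarterPlane :=
    h₁.continuousOn_laplaceInv hη hM hk hkA
  have cu₂ : ContinuousOn (fun z : ℝ × ℝ => u₂ z.1 z.2) quarterPlane :=
    h₂.continuousOn_laplaceInv hη hM hk hkA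
  have cw₁ : ContinuousOn (fun z : ℝ × ℝ => w₁ z.1 z.2) quarterPlane :=
    h₁.continuousOn_laplaceInv hη hM hk' hkA'
  have cw₂ : ContinuousOn (fun z : ℝ × ℝ => w₂ z.1 z.2) quarterPlane :=
    h₂.continuousOn_laplaceInv hη hM hk' hkA'
  have hlift : ∀ f : ℝ → ℝ, ContinuousOn f (Ici 0) →
      ContinuousOn (fun z : ℝ × ℝ => (f z.1 : ℂ)) quarterPlane := fun f hf =>
    Complex.continuous_ofReal.comp_continuousOn (hf.comp continuousOn_fst fun z hz => hz.1)
  have cp := hlift p hp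
  have cq := hlift q hq
  have hvec : ∀ f g : ℝ × ℝ → ℂ, ContinuousOn f quarterPlane → ContinuousOn g quarterPlane →
      ContinuousOn (fun z => ![f z, g z]) quarterPlane := fun f g hf hg =>
    continuousOn_pi.2 fun i => by fin_cases i <;> simpa
  have hvecd : ∀ (f g : ℝ → ℂ) (f' g' : ℂ) (x : ℝ), HasDerivWithinAt f f' (Ici 0) x →
      HasDerivWithinAt g g' (Ici 0) x →
      HasDerivWithinAt (fun y => ![f y, g y]) ![f', g'] (Ici 0) x := fun f g f' g' x hf hg =>
    hasDerivWithinAt_pi.2 fun i => by fin_cases i <;> simpa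
  refine ⟨⟨fun x t => ![q x * u₁ x t + Complex.I * w₂ x t - p x * u₂ x t,
      -(Complex.I * w₁ x t) - p x * u₁ x t - q x * u₂ x t], fun x t => ![w₁ x t, w₂ x t],
      hvec _ _ cu₁ cu₂, hvec _ _ ?_ ?_, hvec _ _ cw₁ cw₂, fun x t hx ht => ⟨?_, ?_, ?_⟩⟩,
      fun x hx => ?_, fun t ht => ?_, fun x t _ htx => ?_⟩
  · exact ((cq.mul cu₁).add (continuousOn_const.mul cw₂)).sub (cp.mul cu₂)
  · exact ((continuousOn_const.mul cw₁).neg.sub (cp.mul cu₁)).sub (cq.mul cu₂)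
  · refine hvecd _ _ _ _ _ ?_ ?_
    · refine (h₁.hasDerivWithinAt_laplaceInv_space (σ := 1) (α := fun x => (q x : ℂ))
        (β := fun x => -(p x : ℂ)) (C := C) h₂ hη hM hk hkA hkA' (fun z hz x hx =>
          (h.deriv_fst z hz x hx).congr_deriv (by ring)) (fun x hx => ?_) (fun x hx => ?_)
        hx t).congr_deriv ?_
      · simpa using (hV x hx).2
      · simpa using (hV x hx).1
      · simp only [u₁, u₂, w₂, k']; ring
    · refine (h₂.hasDerivWithinAt_laplaceInv_space (σ := -1) (α := fun x => -(q x : ℂ))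
        (β := fun x => -(p x : ℂ)) (C := C) h₁ hη hM hk hkA hkA' (fun z hz x hx =>
          (h.deriv_snd z hz x hx).congr_deriv (by ring)) (fun x hx => ?_) (fun x hx => ?_)
        hx t).congr_deriv ?_
      · simpa using (hV x hx).2
      · simpa using (hV x hx).1
      · simp only [u₁, u₂, w₁, k']; ring
  · exact hvecd _ _ _ _ _ (h₁.hasDerivWithinAt_laplaceInv_time hη hM hk hkA hkA' hx ht)
      (h₂.hasDerivWithinAt_laplaceInv_time hη hM hk hkA hkA' hx ht)
  · have hmv : ∀ (A : Matrix (Fin 2) (Fin 2) ℂ) (w : Fin 2 → ℂ) (i : Fin 2),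
        (A *ᵥ w) i = A i 0 * w 0 + A i 1 * w 1 := fun A w i => by
      simp [Matrix.mulVec, dotProduct, Fin.sum_univ_two]
    ext i
    simp only [Pi.add_apply, Pi.smul_apply, hmv]
    fin_cases i <;> simp [J, dynPotential] <;> ring
  · have e1 : u₁ x 0 = 0 := h₁.laplaceInv_eq_zero hη hk hkA3 hx hx
    have e2 : u₂ x 0 = 0 := h₂.laplaceInv_eq_zero hη hk hkA3 hx hx
    simp [e1, e2]
  · simp only [Matrix.cons_val_zero, u₁, laplaceInv]
    have : ∀ ξ, Complex.exp (-Complex.I * hline η ξ * t) * (k (hline η ξ) * Φ₁ (hline η ξ) 0) =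
        Complex.exp (-Complex.I * hline η ξ * t) * k (hline η ξ) := fun ξ => by
      rw [h.fst_zero _ (by simpa), mul_one]
    simp only [this]
    rw [integral_exp_mul_quadControlHat hε hη, inv_mul_cancel_left₀]
    exact_mod_cast (by positivity : (2 * Real.pi) ≠ 0)
  · have hx : 0 ≤ x := by linarith
    have e1 : u₁ x t = 0 := h₁.laplaceInv_eq_zero hη hk hkA3 hx htx.le
    have e2 : u₂ x t = 0 := h₂.laplaceInv_eq_zero hη hk hkA3 hx htx.le
    simp [e1, e2]

/-! ### The response in terms of the Weyl function. -/

/-- The kernel `e^{izx} φ(z)`, which takes the value `φ(z)` at `x = 0`. -/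
noncomputable def weylKernel (φ : ℂ → ℂ) (z : ℂ) (x : ℝ) : ℂ :=
  Complex.exp (Complex.I * z * x) * φ z

@[simp] lemma weylKernel_zero (φ : ℂ → ℂ) (z : ℂ) : weylKernel φ z 0 = φ z := by
  simp [weylKernel]

section Response

variable {p q : ℝ → ℝ} {r : ℝ → ℂ} {φ : ℂ → ℂ} {M : ℝ} {Φ₁ Φ₂ : ℂ → ℝ → ℂ}

/-- Only `x = 0` matters later. The factor `e^{izx}` provides exponential decay with constant `0` in
place of `M`, so that every line `η > 0` is allowed. -/
lemma IsNormalizedWeylFamily.isLaplaceKernel_weylKernel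
    (h : IsNormalizedWeylFamily p q φ M Φ₁ Φ₂) : IsLaplaceKernel 0 (weylKernel φ) where
  continuousOn z hz := by unfold weylKernel; fun_prop
  differentiableOn x hx := by
    unfold weylKernel
    refine DifferentiableOn.mul (by fun_prop) ?_
    exact (h.differentiableOn_snd 0 le_rfl).congr fun z hz => (h.snd_zero z hz).symm
  bound η hη := by
    obtain ⟨B, hB0, hB⟩ := h.bound η hη
    refine ⟨B, hB0, fun z hz x hx => ?_⟩
    have := (hB z hz 0 le_rfl).2
    rw [h.snd_zero z (hη.trans_le hz), mul_zero, Real.exp_zero, mul_one] at this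
    rw [weylKernel, norm_mul, Complex.norm_exp, mul_comm]
    simp
    gcongr

/-- The response to the control `t₊² e^{-εt}`, expressed through the Weyl function. -/
lemma IsNormalizedWeylFamily.laplaceInv_eq_response
    (h : IsNormalizedWeylFamily p q φ M Φ₁ Φ₂)
    (hp : ContinuousOn p (Ici 0)) (hq : ContinuousOn q (Ici 0))
    (hV : ∃ C : ℝ, ∀ x : ℝ, 0 ≤ x → |p x| ≤ C ∧ |q x| ≤ C)
    (hr : IsResponseFunction p q r) {ε η t : ℝ} (hε : 0 < ε) (hη : 0 < η) (ht : 0 ≤ t) :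
    laplaceInv (quadControlHat ε) (weylKernel φ) η 0 t =
      Complex.I * quadControl ε t + ∫ τ in (0 : ℝ)..t, r (t - τ) * quadControl ε τ := by
  obtain ⟨C, hC⟩ := hV
  -- The solution is built on a line with `η' ≥ M`, and the result is then carried to the given `η`
  -- by a contour shift at `x = 0`.
  set η' := max M 1
  have hη' : 0 < η' := lt_of_lt_of_le one_pos (le_max_right _ _)
  have hres := hr.response _ _ (isAdmissibleControl_quadControl hε)
    (h.isDynamicalSolution hε.le hp hq hC hη' (le_max_left _ _)) t ht
  rw [← hres]
  have hG := h.isLaplaceKernel_weylKernel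
  have hk := differentiableOn_quadControlHat hε.le
  have hkA := fun z hz => norm_quadControlHat_le hε.le (z := z) hz
  have e1 : laplaceInv (quadControlHat ε) (weylKernel φ) η' 0 t =
      laplaceInv (quadControlHat ε) Φ₂ η' 0 t := by
    rw [laplaceInv, laplaceInv]
    congr 2
    ext ξ
    rw [h.snd_zero _ (by simpa), weylKernel_zero]
  have e2 : laplaceInv (quadControlHat ε) (weylKernel φ) η 0 t =
      laplaceInv (quadControlHat ε) (weylKernel φ) η' 0 t := by
    rcases le_total η η' with hle | hle
    · exact hG.integral_hline_eq_of_time hk hkA hη hle ht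
    · exact (hG.integral_hline_eq_of_time hk hkA hη' hle ht).symm
  rw [e2, e1]
  simp

lemma continuous_comp_max {r : ℝ → ℂ} (hr : ContinuousOn r (Ici 0)) :
    Continuous fun t => r (max t 0) :=
  hr.comp_continuous (continuous_id.max continuous_const) fun _ => mem_Ici.2 (le_max_right _ _)

/-- The limiting case `ε = 0` of `laplaceInv_eq_response`. -/
lemma IsNormalizedWeylFamily.laplaceInv_zero_eq_response
    (h : IsNormalizedWeylFamily p q φ M Φ₁ Φ₂)
    (hp : ContinuousOn p (Ici 0)) (hq : ContinuousOn q (Ici 0))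
    (hV : ∃ C : ℝ, ∀ x : ℝ, 0 ≤ x → |p x| ≤ C ∧ |q x| ≤ C)
    (hr : IsResponseFunction p q r) {η t : ℝ} (hη : 0 < η) (ht : 0 ≤ t) :
    laplaceInv (quadControlHat 0) (weylKernel φ) η 0 t =
      Complex.I * t ^ 2 + ∫ τ in (0 : ℝ)..t, r (max (t - τ) 0) * (max τ 0 : ℝ) ^ 2 := by
  have hG := h.isLaplaceKernel_weylKernel
  obtain ⟨B, hB0, hB⟩ := hG.bound η hη
  have hBφ : ∀ ξ, ‖weylKernel φ (hline η ξ) 0‖ ≤ B := fun ξ => by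
    simpa using hB (hline η ξ) (by simp) 0 le_rfl
  -- The control `t₊²` is unbounded, hence not admissible; its formula is reached as the limit `ε →
  -- 0+` on both sides.
  have hleft : Tendsto (fun ε => laplaceInv (quadControlHat ε) (weylKernel φ) η 0 t) (𝓝[>] 0)
      (𝓝 (laplaceInv (quadControlHat 0) (weylKernel φ) η 0 t)) := by
    refine Tendsto.const_mul _ ?_
    refine tendsto_integral_filter_of_dominated_convergence
      (fun ξ => Real.exp (η * t) * (2 / η * B) * (‖hline η ξ‖ ^ 2)⁻¹) ?_ ?_
      ((integrable_inv_norm_hline_sq hη).const_mul _) ?_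
    · filter_upwards [self_mem_nhdsWithin] with ε hε
      exact (continuous_comp_hline (hG.differentiableOn_integrand
        (differentiableOn_quadControlHat (le_of_lt hε)) le_rfl t) hη).aestronglyMeasurable
    · filter_upwards [self_mem_nhdsWithin] with ε hε
      refine Eventually.of_forall fun ξ => ?_
      have h1 := (norm_quadControlHat_le_of_im_eq (le_of_lt hε) hη (hline_im η ξ)).1
      rw [norm_mul, norm_mul, norm_exp_mul, hline_im]
      calc _ ≤ Real.exp (η * t) * (2 / η * (‖hline η ξ‖ ^ 2)⁻¹ * B) := by
            gcongr
            exact hBφ ξ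
        _ = _ := by ring
    · refine Eventually.of_forall fun ξ => ?_
      refine Tendsto.const_mul _ (Tendsto.mul_const _ ?_)
      have hc : ContinuousAt (fun ε : ℝ => quadControlHat ε (hline η ξ)) 0 := by
        unfold quadControlHat
        refine ContinuousAt.div (by fun_prop) (by fun_prop) ?_
        exact pow_ne_zero 3 (sub_I_mul_ne_zero le_rfl (by simpa))
      exact hc.tendsto.mono_left nhdsWithin_le_nhds
  have hr' := continuous_comp_max hr.continuousOn
  have hright : Tendsto (fun ε => Complex.I * quadControl ε t +
      ∫ τ in (0 : ℝ)..t, r (max (t - τ) 0) * quadControl ε τ) (𝓝[>] 0)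
      (𝓝 (Complex.I * quadControl 0 t +
        ∫ τ in (0 : ℝ)..t, r (max (t - τ) 0) * quadControl 0 τ)) := by
    have hcont : Continuous fun ε => Complex.I * quadControl ε t +
        ∫ τ in (0 : ℝ)..t, r (max (t - τ) 0) * quadControl ε τ := by
      refine Continuous.add (by unfold quadControl; fun_prop) ?_
      refine intervalIntegral.continuous_parametric_intervalIntegral_of_continuous' ?_ 0 t
      refine Continuous.mul (hr'.comp (by fun_prop : Continuous fun w : ℝ × ℝ => t - w.2)) ?_
      unfold quadControl
      fun_prop
    exact hcont.continuousAt.tendsto.mono_left nhdsWithin_le_nhds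
  have heq : (fun ε => laplaceInv (quadControlHat ε) (weylKernel φ) η 0 t) =ᶠ[𝓝[>] 0]
      fun ε => Complex.I * quadControl ε t +
        ∫ τ in (0 : ℝ)..t, r (max (t - τ) 0) * quadControl ε τ := by
    filter_upwards [self_mem_nhdsWithin] with ε hε
    rw [h.laplaceInv_eq_response hp hq hV hr hε hη ht]
    congr 1
    refine intervalIntegral.integral_congr fun τ hτ => ?_
    rw [uIcc_of_le ht] at hτ
    rw [max_eq_left (sub_nonneg.2 hτ.2)]
  rw [tendsto_nhds_unique (hleft.congr' heq) hright]
  simp only [quadControl, neg_zero, zero_mul, Real.exp_zero, mul_one, max_eq_left ht,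
    Complex.ofReal_pow]

/-- Moments of the response function. -/
noncomputable def moment (r : ℝ → ℂ) (k : ℕ) (t : ℝ) : ℂ :=
  ∫ σ in (0 : ℝ)..t, r (max σ 0) * (σ : ℂ) ^ k

lemma hasDerivAt_moment (hr : ContinuousOn r (Ici 0)) (k : ℕ) (t : ℝ) :
    HasDerivAt (moment r k) (r (max t 0) * (t : ℂ) ^ k) t := by
  have hc : Continuous fun σ : ℝ => r (max σ 0) * (σ : ℂ) ^ k :=
    (continuous_comp_max hr).mul (by fun_prop)
  exact (hc.integral_hasStrictDerivAt 0 t).hasDerivAt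

/-- Expanding `(t - σ)²` takes `t` out of the integrand, so that later differentiation in `t` needs
only the fundamental theorem of calculus. -/
lemma integral_response_eq_moments (hr : ContinuousOn r (Ici 0)) {t : ℝ} (ht : 0 ≤ t) :
    ∫ τ in (0 : ℝ)..t, r (max (t - τ) 0) * (max τ 0 : ℝ) ^ 2 =
      t ^ 2 * moment r 0 t - 2 * t * moment r 1 t + moment r 2 t := by
  have h1 : ∫ τ in (0 : ℝ)..t, r (max (t - τ) 0) * ((max τ 0 : ℝ) : ℂ) ^ 2 =
      ∫ τ in (0 : ℝ)..t, r (max (t - τ) 0) * ((t : ℂ) - ((t - τ : ℝ) : ℂ)) ^ 2 := by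
    refine intervalIntegral.integral_congr fun τ hτ => ?_
    rw [uIcc_of_le ht] at hτ
    rw [max_eq_left hτ.1]
    push_cast
    ring
  have h2 := intervalIntegral.integral_comp_sub_left (a := 0) (b := t)
    (fun σ : ℝ => r (max σ 0) * ((t : ℂ) - (σ : ℂ)) ^ 2) t
  rw [h1, h2, sub_self, sub_zero]
  have hc : ∀ k : ℕ, IntervalIntegrable (fun σ : ℝ => r (max σ 0) * (σ : ℂ) ^ k) volume 0 t :=
    fun k => ((continuous_comp_max hr).mul (by fun_prop)).intervalIntegrable _ _
  simp only [moment]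
  rw [← intervalIntegral.integral_const_mul, ← intervalIntegral.integral_const_mul,
    ← intervalIntegral.integral_sub ((hc 0).const_mul _) ((hc 1).const_mul _),
    ← intervalIntegral.integral_add (((hc 0).const_mul _).sub ((hc 1).const_mul _)) (hc 2)]
  refine intervalIntegral.integral_congr fun σ _ => ?_
  ring

/-- The Laplace inversion formula that recovers the response function from the Weyl function. -/
theorem IsNormalizedWeylFamily.integral_weighted_eq
    (h : IsNormalizedWeylFamily p q φ M Φ₁ Φ₂)
    (hp : ContinuousOn p (Ici 0)) (hq : ContinuousOn q (Ici 0))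
    (hV : ∃ C : ℝ, ∀ x : ℝ, 0 ≤ x → |p x| ≤ C ∧ |q x| ≤ C)
    (hr : IsResponseFunction p q r) {η t : ℝ} (hη : 0 < η) (ht : 0 < t) :
    (Real.exp (η * t) : ℂ) *
        ∫ ξ : ℝ, Complex.exp (-Complex.I * (ξ : ℂ) * (t : ℂ)) * weighted φ η ξ =
      -(2 * Real.pi) * (Complex.I * t + t * moment r 0 t - moment r 1 t) := by
  have hG := h.isLaplaceKernel_weylKernel
  have hkA := fun z hz => (norm_quadControlHat_le_of_im_eq le_rfl hη (z := z) hz).1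
  have hkA' := fun z hz => (norm_quadControlHat_le_of_im_eq le_rfl hη (z := z) hz).2
  have hd1 := (hG.hasDerivWithinAt_laplaceInv_time hη hη.le
    (differentiableOn_quadControlHat le_rfl) hkA hkA' (le_refl 0) ht.le).hasDerivAt
    (Ici_mem_nhds ht)
  have hrc := hr.continuousOn
  have hof : HasDerivAt (fun t : ℝ => (t : ℂ)) 1 t := Complex.ofRealCLM.hasDerivAt
  -- The terms containing `r` itself cancel: `t² r - 2t·t r + t² r = 0`.
  have hd2 : HasDerivAt (fun t : ℝ => Complex.I * (t : ℂ) ^ 2 +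
      ((t : ℂ) ^ 2 * moment r 0 t - 2 * t * moment r 1 t + moment r 2 t))
      (2 * (Complex.I * t + t * moment r 0 t - moment r 1 t)) t := by
    refine (((hof.pow 2).const_mul Complex.I).add ((((hof.pow 2).mul
      (hasDerivAt_moment hrc 0 t)).sub ((hof.const_mul 2).mul (hasDerivAt_moment hrc 1 t))).add
      (hasDerivAt_moment hrc 2 t))).congr_deriv ?_
    simp
    ring
  have heq : (fun t => laplaceInv (quadControlHat 0) (weylKernel φ) η 0 t) =ᶠ[𝓝 t]
      fun t : ℝ => Complex.I * (t : ℂ) ^ 2 +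
        ((t : ℂ) ^ 2 * moment r 0 t - 2 * t * moment r 1 t + moment r 2 t) := by
    filter_upwards [Ioi_mem_nhds ht] with s hs
    rw [h.laplaceInv_zero_eq_response hp hq hV hr hη (le_of_lt hs),
      integral_response_eq_moments hrc (le_of_lt hs)]
  have hval := hd1.unique (hd2.congr_of_eventuallyEq heq)
  rw [laplaceInv_eq_exp_mul] at hval
  have hint : ∫ ξ : ℝ, Complex.exp (-Complex.I * ξ * t) *
      (-Complex.I * hline η ξ * quadControlHat 0 (hline η ξ) * weylKernel φ (hline η ξ) 0) =
      -2 * ∫ ξ : ℝ, Complex.exp (-Complex.I * (ξ : ℂ) * (t : ℂ)) * weighted φ η ξ := by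
    rw [← integral_const_mul]
    refine integral_congr_ae (Eventually.of_forall fun ξ => ?_)
    simp only [weylKernel_zero]
    have e : weighted φ η ξ = (hline η ξ)⁻¹ ^ 2 * φ (hline η ξ) := rfl
    -- At `ε = 0` the differentiated symbol is `2/(-iz)² = -2 z⁻²`, the weight in the definition of
    -- `s`.
    have e' : -Complex.I * hline η ξ * quadControlHat 0 (hline η ξ) =
        -2 * (hline η ξ)⁻¹ ^ 2 := by
      have hne := hline_ne_zero hη ξ
      rw [quadControlHat]
      simp only [Complex.ofReal_zero, zero_sub]
      field_simp
      rw [Complex.I_sq]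
      norm_num
    rw [e, e']
    ring
  rw [hint] at hval
  generalize (∫ ξ : ℝ, Complex.exp (-Complex.I * (ξ : ℂ) * (t : ℂ)) * weighted φ η ξ) = X
    at hval ⊢
  have hpi : (Real.pi : ℂ) ≠ 0 := by exact_mod_cast Real.pi_ne_zero
  field_simp at hval
  linear_combination -hval

end Response

/-! ### The limit in the mean -/

/-- `φ` is bounded on the line, so the weighted function decays quadratically: it is integrable and
bounded, hence also square integrable. -/
lemma integrable_and_memLp_weighted {p q : ℝ → ℝ} {φ : ℂ → ℂ} {M : ℝ} {Φ₁ Φ₂ : ℂ → ℝ → ℂ}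
    (h : IsNormalizedWeylFamily p q φ M Φ₁ Φ₂) {η : ℝ} (hη : 0 < η) :
    Integrable (weighted φ η) ∧ MemLp (weighted φ η) 2 volume := by
  have hG := h.isLaplaceKernel_weylKernel
  obtain ⟨B, hB0, hB⟩ := hG.bound η hη
  have hφd : DifferentiableOn ℂ φ upperPlane :=
    (hG.differentiableOn 0 le_rfl).congr fun z _ => (weylKernel_zero φ z).symm
  have hd : DifferentiableOn ℂ (fun z => z⁻¹ ^ 2 * φ z) upperPlane := by
    refine DifferentiableOn.mul (DifferentiableOn.pow (differentiableOn_id.inv fun z hz => ?_) 2)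
      hφd
    rintro rfl
    simp [upperPlane] at hz
  have hb : ∀ z : ℂ, z.im = η → ‖z⁻¹ ^ 2 * φ z‖ ≤ B * (‖z‖ ^ 2)⁻¹ := by
    intro z hz
    have := hB z hz.ge 0 le_rfl
    rw [weylKernel_zero, mul_zero, Real.exp_zero, mul_one] at this
    rw [norm_mul, norm_pow, norm_inv, inv_pow, mul_comm]
    gcongr
  have hint : Integrable (weighted φ η) := integrable_comp_hline hd hη hb
  have hcont : Continuous (weighted φ η) := continuous_comp_hline hd hη
  refine ⟨hint, (memLp_two_iff_integrable_sq_norm hcont.aestronglyMeasurable).2 ?_⟩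
  refine Integrable.mono' (hint.norm.const_mul (B * (η ^ 2)⁻¹))
    (hcont.norm.pow 2).aestronglyMeasurable (Eventually.of_forall fun ξ => ?_)
  have h1 : ‖weighted φ η ξ‖ ≤ B * (‖hline η ξ‖ ^ 2)⁻¹ := hb _ (hline_im η ξ)
  have h2 : ‖weighted φ η ξ‖ ≤ B * (η ^ 2)⁻¹ := h1.trans (by gcongr; exact le_norm_hline ξ)
  rw [Real.norm_of_nonneg (by positivity), sq]
  gcongr

lemma tendsto_eLpNorm_indicator_compl_Ioc {f : ℝ → ℂ} (hf : MemLp f 2) :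
    Tendsto (fun a : ℝ => eLpNorm ((Ioc (-a) a)ᶜ.indicator f) 2 volume) atTop (𝓝 0) := by
  have hfin := lintegral_rpow_enorm_lt_top_of_eLpNorm_lt_top two_ne_zero ENNReal.ofNat_ne_top hf.2
  have hlim : Tendsto (fun a : ℝ => ∫⁻ x, ‖(Ioc (-a) a)ᶜ.indicator f x‖ₑ ^ (2 : ENNReal).toReal)
      atTop (𝓝 (∫⁻ _ : ℝ, 0)) := by
    refine tendsto_lintegral_filter_of_dominated_convergence'
      (fun x => ‖f x‖ₑ ^ (2 : ENNReal).toReal) ?_ ?_ hfin.ne ?_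
    · exact Eventually.of_forall fun a =>
        (hf.1.indicator measurableSet_Ioc.compl).enorm.pow_const _
    · refine Eventually.of_forall fun a => Eventually.of_forall fun x => ?_
      gcongr
      exact enorm_indicator_le_enorm_self _ _
    · refine Eventually.of_forall fun x => ?_
      refine tendsto_const_nhds.congr' ?_
      filter_upwards [eventually_gt_atTop |x|] with a ha
      have hx : x ∉ (Ioc (-a) a)ᶜ := by
        rw [notMem_compl_iff]
        exact ⟨(abs_lt.1 ha).1, (abs_lt.1 ha).2.le⟩
      rw [indicator_of_notMem hx]
      simp
  simp only [eLpNorm_eq_lintegral_rpow_enorm_toReal two_ne_zero ENNReal.ofNat_ne_top]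
  have := (ENNReal.continuous_rpow_const (y := 1 / (2 : ENNReal).toReal)).tendsto
    (∫⁻ _ : ℝ, (0 : ENNReal))
  refine (this.comp hlim).trans ?_
  simp

/-- The truncation error is the transform of the tail of the weighted function. By Plancherel its
norm over `ℝ` is a constant times the norm of the tail, and restriction to `(0, ∞)` only decreases
it. -/
lemma isLimInMean_truncated {φ : ℂ → ℂ} {η : ℝ} (hint : Integrable (weighted φ η))
    (hL2 : MemLp (weighted φ η) 2 volume) :
    IsLimInMean (truncated φ η) fun x =>
      ∫ ξ : ℝ, Complex.exp (-Complex.I * (ξ : ℂ) * (x : ℂ)) * weighted φ η ξ := by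
  set T : (ℝ → ℂ) → ℝ → ℂ := fun f x =>
    ∫ ξ : ℝ, Complex.exp (-Complex.I * (ξ : ℂ) * (x : ℂ)) * f ξ with hT
  have hexp : ∀ f : ℝ → ℂ, Integrable f → ∀ x : ℝ,
      Integrable fun ξ : ℝ => Complex.exp (-Complex.I * (ξ : ℂ) * (x : ℂ)) * f ξ := by
    intro f hf x
    refine hf.bdd_mul (c := 1) (by fun_prop) (Eventually.of_forall fun ξ => ?_)
    rw [Complex.norm_exp]; simp
  have hind : ∀ s : Set ℝ, MeasurableSet s → Integrable (s.indicator (weighted φ η)) ∧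
      MemLp (s.indicator (weighted φ η)) 2 volume := fun s hs => ⟨hint.indicator hs, hL2.indicator hs⟩
  have htrunc : ∀ a, 0 < a → truncated φ η a = T ((Ioc (-a) a).indicator (weighted φ η)) := by
    intro a ha
    ext x
    rw [truncated, intervalIntegral.integral_of_le (by linarith),
      ← integral_indicator measurableSet_Ioc]
    refine integral_congr_ae (Eventually.of_forall fun ξ => ?_)
    simp only [indicator_apply, mul_ite, mul_zero]
  refine ⟨fun a ha => ?_, ?_, ?_⟩
  · rw [htrunc a ha]
    exact (memLp_integral_exp_and_eLpNorm_eq (hind _ measurableSet_Ioc).1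
      (hind _ measurableSet_Ioc).2).1.restrict _
  · exact (memLp_integral_exp_and_eLpNorm_eq hint hL2).1.restrict _
  · have hlim := ENNReal.Tendsto.const_mul (tendsto_eLpNorm_indicator_compl_Ioc hL2)
      (a := ENNReal.ofReal |(2 * Real.pi)| ^ (1 / 2 : ℝ)) (Or.inr
        (ENNReal.rpow_lt_top_of_nonneg (by norm_num) ENNReal.ofReal_ne_top).ne)
    rw [mul_zero] at hlim
    refine tendsto_of_tendsto_of_tendsto_of_le_of_le' tendsto_const_nhds hlim
      (Eventually.of_forall fun _ => zero_le) ?_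
    filter_upwards [eventually_gt_atTop 0] with a ha
    have hc := hind _ (measurableSet_Ioc (a := -a) (b := a)).compl
    rw [← (memLp_integral_exp_and_eLpNorm_eq hc.1 hc.2).2, htrunc a ha]
    have hdiff : (fun x => T ((Ioc (-a) a).indicator (weighted φ η)) x - T (weighted φ η) x) =
        -(T ((Ioc (-a) a)ᶜ.indicator (weighted φ η))) := by
      ext x
      have e : T (weighted φ η) x = T ((Ioc (-a) a).indicator (weighted φ η)) x +
          T ((Ioc (-a) a)ᶜ.indicator (weighted φ η)) x := by
        simp only [hT]
        rw [← integral_add (hexp _ (hind _ measurableSet_Ioc).1 x) (hexp _ hc.1 x)]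
        refine integral_congr_ae (Eventually.of_forall fun ξ => ?_)
        simp only
        rw [← mul_add, ← Pi.add_apply, indicator_self_add_compl]
      rw [e, Pi.neg_apply]
      ring
    calc _ = eLpNorm (fun x => T ((Ioc (-a) a).indicator (weighted φ η)) x -
          T (weighted φ η) x) 2 (volume.restrict (Ioi 0)) := rfl
      _ = eLpNorm (T ((Ioc (-a) a)ᶜ.indicator (weighted φ η))) 2 (volume.restrict (Ioi 0)) := by
          rw [hdiff, eLpNorm_neg]
      _ ≤ _ := eLpNorm_mono_measure _ Measure.restrict_le_self

lemma IsLimInMean.ae_eq {F : ℝ → ℝ → ℂ} {g g₁ : ℝ → ℂ} (h : IsLimInMean F g)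
    (h₁ : IsLimInMean F g₁) : g =ᵐ[volume.restrict (Ioi 0)] g₁ := by
  have hsum := h.2.2.add h₁.2.2
  rw [add_zero] at hsum
  have hle : ∀ᶠ a in atTop, eLpNorm (g - g₁) 2 (volume.restrict (Ioi 0)) ≤
      eLpNorm (fun x => F a x - g x) 2 (volume.restrict (Ioi 0)) +
        eLpNorm (fun x => F a x - g₁ x) 2 (volume.restrict (Ioi 0)) := by
    filter_upwards [eventually_gt_atTop 0] with a ha
    have e : g - g₁ = (fun x => F a x - g₁ x) - fun x => F a x - g x := by
      ext x; simp
    rw [e, add_comm]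
    exact eLpNorm_sub_le (((h.1 a ha).sub h₁.2.1).1) (((h.1 a ha).sub h.2.1).1) one_le_two
  have h0 := ge_of_tendsto hsum hle
  rw [nonpos_iff_eq_zero, eLpNorm_eq_zero_iff (h.2.1.sub h₁.2.1).1 two_ne_zero] at h0
  filter_upwards [h0] with x hx
  exact sub_eq_zero.1 hx

/-- Two limits in the mean agree almost everywhere. Times the exponential factor both are
differentiable, hence continuous, so they agree at every point of `(0, ∞)`, and so do their
derivatives. -/
lemma IsGivenByWeyl.eqOn {φ : ℂ → ℂ} {η : ℝ} {s s₁ : ℝ → ℂ} (h : IsGivenByWeyl φ η s)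
    (h₁ : IsGivenByWeyl φ η s₁) : EqOn s₁ s (Ioi 0) := by
  obtain ⟨_, g, hg, hd⟩ := h
  obtain ⟨_, g₁, hg₁, hd₁⟩ := h₁
  have hae := hg.ae_eq hg₁
  have heq : EqOn (fun x : ℝ => Complex.I / (4 * (Real.pi : ℂ)) * (Real.exp (η * x) : ℂ) * g x)
      (fun x : ℝ => Complex.I / (4 * (Real.pi : ℂ)) * (Real.exp (η * x) : ℂ) * g₁ x) (Ioi 0) := by
    refine Measure.eqOn_open_of_ae_eq (μ := volume) ?_ isOpen_Ioi
      (fun x hx => (hd x hx).continuousAt.continuousWithinAt)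
      (fun x hx => (hd₁ x hx).continuousAt.continuousWithinAt)
    filter_upwards [hae] with x hx
    rw [hx]
  intro x hx
  have hev : (fun x : ℝ => Complex.I / (4 * (Real.pi : ℂ)) * (Real.exp (η * x) : ℂ) * g₁ x)
      =ᶠ[𝓝 x] fun x : ℝ =>
        Complex.I / (4 * (Real.pi : ℂ)) * (Real.exp (η * x) : ℂ) * g x := by
    filter_upwards [Ioi_mem_nhds hx] with y hy
    exact (heq hy).symm
  exact (starRingEnd ℂ).injective ((hd₁ x hx).unique ((hd x hx).congr_of_eventuallyEq hev))

/-- The response function of the dynamical Dirac system is the `A`-amplitude of the corresponding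
spectral Dirac system. -/
theorem IsResponseFunction.exists_eq_aAmplitude (p q : ℝ → ℝ)
    (hp : ContDiffOn ℝ 1 p (Ici 0)) (hq : ContDiffOn ℝ 1 q (Ici 0))
    (hV : ∃ C : ℝ, ∀ x : ℝ, 0 ≤ x → |p x| ≤ C ∧ |q x| ≤ C)
    (r : ℝ → ℂ) (hr : IsResponseFunction p q r)
    (φ : ℂ → ℂ) (hφ : IsHerglotzWeyl (assocV p q) φ) :
    ∃ s : ℝ → ℂ,
      (∀ η : ℝ, 0 < η →
        IsGivenByWeyl φ η s ∧
        ∀ s₁ : ℝ → ℂ, IsGivenByWeyl φ η s₁ → EqOn s₁ s (Ioi 0)) ∧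
      DifferentiableOn ℝ s (Ioi 0) ∧
      ∀ t : ℝ, 0 < t → r t = aAmplitude s t := by
  obtain ⟨M, Φ₁, Φ₂, -, h⟩ := hφ.exists_isNormalizedWeylFamily hp hq hV
  have hrc := hr.continuousOn
  -- Read off from `integral_weighted_eq`: the expression to be differentiated is `-(i/2)(i t + ∫₀ᵗ
  -- (t - σ) r(σ) dσ)`. It does not involve `η`, so one `s` serves all `η`.
  set s : ℝ → ℂ := fun x => (starRingEnd ℂ) (1 / 2 - Complex.I / 2 * moment r 0 x) with hs
  have hsd : ∀ x, 0 < x → HasDerivAt s ((starRingEnd ℂ) (-(Complex.I / 2 * r x))) x := by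
    intro x hx
    refine ((((hasDerivAt_moment hrc 0 x).const_mul (Complex.I / 2)).const_sub
      (1 / 2)).star).congr_deriv ?_
    rw [max_eq_left hx.le, pow_zero, mul_one]
    rfl
  have hgiven : ∀ η : ℝ, 0 < η → IsGivenByWeyl φ η s := by
    intro η hη
    obtain ⟨hint, hL2⟩ := integrable_and_memLp_weighted h hη
    refine ⟨hL2, _, isLimInMean_truncated hint hL2, fun x hx => ?_⟩
    have hof : HasDerivAt (fun t : ℝ => (t : ℂ)) 1 x := Complex.ofRealCLM.hasDerivAt
    have hd : HasDerivAt (fun t : ℝ => -(Complex.I / 2) *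
        (Complex.I * t + t * moment r 0 t - moment r 1 t))
        ((starRingEnd ℂ) (s x)) x := by
      refine ((((hof.const_mul Complex.I).add (hof.mul (hasDerivAt_moment hrc 0 x))).sub
        (hasDerivAt_moment hrc 1 x)).const_mul (-(Complex.I / 2))).congr_deriv ?_
      rw [hs]
      simp only [Complex.conj_conj]
      ring_nf
      rw [Complex.I_sq]
      ring
    refine hd.congr_of_eventuallyEq ?_
    filter_upwards [Ioi_mem_nhds hx] with t ht
    rw [mul_assoc, h.integral_weighted_eq hp.continuousOn hq.continuousOn hV hr hη ht]
    have hpi : (Real.pi : ℂ) ≠ 0 := by exact_mod_cast Real.pi_ne_zero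
    field_simp
    ring
  refine ⟨s, fun η hη => ⟨hgiven η hη, fun s₁ hs₁ => (hgiven η hη).eqOn hs₁⟩,
    fun x hx => (hsd x hx).differentiableAt.differentiableWithinAt, fun t ht => ?_⟩
  rw [aAmplitude, (hsd t ht).deriv, Complex.conj_conj]
  linear_combination (r t) * Complex.I_sq

end DiracResponse

theorem mainTheorem1 (p q : ℝ → ℝ)
    (hp : ContDiffOn ℝ 1 p (Ici 0)) (hq : ContDiffOn ℝ 1 q (Ici 0))
    (hV : ∃ C : ℝ, ∀ x : ℝ, 0 ≤ x → |p x| ≤ C ∧ |q x| ≤ C)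
    (r : ℝ → ℂ) (hr : DiracResponse.IsResponseFunction p q r)
    (φ : ℂ → ℂ) (hφ : DiracResponse.IsHerglotzWeyl (DiracResponse.assocV p q) φ) :
    ∃ s : ℝ → ℂ,
      (∀ η : ℝ, 0 < η →
        DiracResponse.IsGivenByWeyl φ η s ∧
        ∀ s₁ : ℝ → ℂ, DiracResponse.IsGivenByWeyl φ η s₁ → EqOn s₁ s (Ioi 0)) ∧
      DifferentiableOn ℝ s (Ioi 0) ∧
      ∀ t : ℝ, 0 < t → r t = DiracResponse.aAmplitude s t :=
  hr.exists_eq_aAmplitude p q hp hq hV r φ hφ
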